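/- Games are two-player (possibly partizan) games under misère play (a player who is to move and cannot move wins). They may have infinitely many subpositions but admit no infinite runs (transfinite, non-loopy games). Write $G+H$ for the disjunctive sum, $0$ for the game without moves, $G^L$, $G^R$ for the Left and Right options of $G$, and $G\cong H$ if the game trees of $G$ and $H$ are isomorphic, where the options of a position form a set, so that isomorphic options count once. A game is impartial if in every position both players have the same options; $G'$ then denotes an option of $G$. Let $o^-(G)\in\{\mathcal L,\mathcal R,\mathcal P,\mathcal N\}$ be the misère outcome (Left, Right, the previous player, the next player wins), ordered by $\mathcal L\ge\mathcal P\ge\mathcal R$, $\mathcal L\ge\mathcal N\ge\mathcal R$, with $\mathcal P,\mathcal N$ incomparable. Let $G\ge H$ mean $o^-(G+X)\ge o^-(H+X)$ for all games $X$; let $G=H$ mean $G\ge H$ and $H\ge G$; let $G\equiv H$ mean $o^-(G+X)=o^-(H+X)$ for all impartial games $X$. A Transfinite Nim position is a disjunctive sum of finitely many heaps whose sizes are arbitrary ordinals; a move replaces one heap with a heap of smaller size. Every ordinal is uniquely $2m$ (even) or $2m+1$ (odd). For an ordinal $n$ let $n\oplus1$ be $n+1$ if $n$ is even and the predecessor $n-1$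 if $n$ is odd. The reduced form of a Nim position is obtained as follows: (a) as long as there are at least two odd heaps, replace the lowest pair of odd heaps with heaps of size one less; (b) if there is then an odd heap and it is not the largest heap, replace it with a heap of size one less and replace one of the largest heaps with a heap of size one greater; (c) delete all empty heaps. Then the following hold. 1. For impartial $G,H$: $G\equiv H$ if and only if (i) for every $H'$ there is an option $H''$ of $H'$ with $H''\equiv G$ or an option $G'$ of $G$ with $G'\equiv H'$; (ii) for every $G'$ there is an option $G''$ of $G'$ with $G''\equiv H$ or an option $H'$ of $H$ with $H'\equiv G'$; (iii) if $G\cong0$ then $o^-(H)=\mathcal N$, and if $H\cong0$ then $o^-(G)=\mathcal N$. 2. For all $G,H$: $G\ge H$ if and only if (i) for every $H^L$ there is an option $H^{LR}$ with $H^{LR}\le G$ or an option $G^L$ with $G^L\ge H^L$; (ii) for every $G^R$ there is an option $G^{RL}$ with $G^{RL}\ge H$ or an option $H^R$ with $H^R\le G^R$; (iii) if $H$ has no Left options, then neither does $G$; (iv) if $G$ has no Right options, then neither does $H$. 3. For impartial $G,H$: $G=H$ if and only if (i) for every $H'$ there is an option $H''$ of $H'$ with $H''=G$ or an option $G'$ of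 $G$ with $G'=H'$; (ii) for every $G'$ there is an option $G''$ of $G'$ with $G''=H$ or an option $H'$ of $H$ with $H'=G'$; (iii) $G\cong0$ if and only if $H\cong0$. 4. Two Transfinite Nim positions are isomorphic if and only if their multisets of nonzero heap sizes agree, and they are equal (that is, $G=H$) if and only if they are isomorphic. 5. For every ordinal $n$, the sum of heaps of sizes $n$ and $1$ is impartially equivalent to the single heap of size $n\oplus1$. 6. Every Transfinite Nim position is impartially equivalent to its reduced form, and two Transfinite Nim positions are impartially equivalent if and only if their reduced forms are isomorphic. -/

import Mathlib

universe u

namespace MisereNim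

/-- A two-player game form: Left's options are indexed by `α`, Right's by `β`. Index types are
arbitrary small types, so a game may have infinitely many subpositions, and well-foundedness of
the inductive type says exactly that there are no infinite runs. -/
inductive Game : Type (u + 1)
  | mk (α β : Type u) (L : α → Game) (R : β → Game) : Game

namespace Game

/-- The set of positions Left can move to. -/
def leftOptions : Game.{u} → Set Game.{u}
  | mk _ _ L _ => Set.range L

/-- The set of positions Right can move to. -/
def rightOptions : Game.{u} → Set Game.{u}
  | mk _ _ _ R => Set.range R

/-- The options of a game. (For an impartial game both players have the same options, up to
isomorphism.) -/
def options (G : Game.{u}) : Set Game.{u} := G.leftOptions ∪ G.rightOptions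

/-- The game without moves. -/
instance : Zero Game.{u} := ⟨mk PEmpty PEmpty PEmpty.elim PEmpty.elim⟩

/-- Auxiliary recursion on the second summand: `fL i` and `fR j` add the options of the first
summand to a given game. -/
def addAux {α β : Type u} (fL : α → Game.{u} → Game.{u}) (fR : β → Game.{u} → Game.{u}) :
    Game.{u} → Game.{u}
  | mk γ δ L' R' =>
    mk (α ⊕ γ) (β ⊕ δ)
      (Sum.elim (fun i => fL i (mk γ δ L' R')) (fun k => addAux fL fR (L' k)))
      (Sum.elim (fun j => fR j (mk γ δ L' R')) (fun l => addAux fL fR (R' l)))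

/-- Disjunctive sum; see `mk_add_mk` for the defining equation. -/
def add : Game.{u} → Game.{u} → Game.{u}
  | mk _ _ L R => addAux (fun i => add (L i)) (fun j => add (R j))

instance : Add Game.{u} := ⟨add⟩

/-- In a disjunctive sum a player moves in exactly one of the summands. -/
theorem mk_add_mk {α β γ δ : Type u} (L : α → Game.{u}) (R : β → Game.{u})
    (L' : γ → Game.{u}) (R' : δ → Game.{u}) :
    mk α β L R + mk γ δ L' R' =
      mk (α ⊕ γ) (β ⊕ δ)
        (Sum.elim (fun i => L i + mk γ δ L' R') (fun k => mk α β L R + L' k))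
        (Sum.elim (fun j => R j + mk γ δ L' R') (fun l => mk α β L R + R' l)) :=
  rfl

/-- Isomorphism `G ≅ H` of game trees. As usual the options of a position form a set, so
several moves that lead to isomorphic positions count as one option. -/
def Iso : Game.{u} → Game.{u} → Prop
  | mk _ _ L R, mk _ _ L' R' =>
    (∀ i, ∃ i', Iso (L i) (L' i')) ∧ (∀ i', ∃ i, Iso (L i) (L' i')) ∧
    (∀ j, ∃ j', Iso (R j) (R' j')) ∧ (∀ j', ∃ j, Iso (R j) (R' j'))

/-- A game is impartial if in every position both players have the same options. -/
def IsImpartial : Game.{u} → Prop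
  | mk _ _ L R =>
    (∀ i, ∃ j, Iso (L i) (R j)) ∧ (∀ j, ∃ i, Iso (L i) (R j)) ∧
    (∀ i, IsImpartial (L i)) ∧ (∀ j, IsImpartial (R j))

/-- Misère play: a player who is to move and has no move wins. The first component says that
Left, moving first, has a winning strategy, the second that Right, moving first, has one. -/
def winsFirst : Game.{u} → Prop × Prop
  | mk α β L R =>
    (IsEmpty α ∨ ∃ i, ¬ (winsFirst (L i)).2, IsEmpty β ∨ ∃ j, ¬ (winsFirst (R j)).1)

end Game

/-- Outcome classes: `L` (Left wins), `R` (Right wins), `P` (the previous player wins),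
`N` (the next player wins). -/
inductive Outcome
  | L | R | P | N

/-- `L` is the largest outcome, `R` the smallest, and `P`, `N` are incomparable. -/
instance : PartialOrder Outcome where
  le a b := a = b ∨ a = .R ∨ b = .L
  le_refl a := Or.inl rfl
  le_trans a b c h₁ h₂ := by cases a <;> cases b <;> cases c <;> simp_all
  le_antisymm a b h₁ h₂ := by cases a <;> cases b <;> simp_all

namespace Game

open scoped Classical in
/-- The misère outcome. -/
noncomputable def outcome (G : Game.{u}) : Outcome :=
  if G.winsFirst.1 then
    if G.winsFirst.2 then .N else .L
  else
    if G.winsFirst.2 then .R else .P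

/-- `G ≥ H` under misère play: `o⁻(G + X) ≥ o⁻(H + X)` for all games `X`. -/
def Geq (G H : Game.{u}) : Prop := ∀ X : Game.{u}, outcome (G + X) ≥ outcome (H + X)

/-- Equality (partizan equivalence) of games: `G ≥ H` and `H ≥ G`. -/
def PartEquiv (G H : Game.{u}) : Prop := Geq G H ∧ Geq H G

/-- Impartial equivalence: `o⁻(G + X) = o⁻(H + X)` for all impartial games `X`. -/
def ImpEquiv (G H : Game.{u}) : Prop :=
  ∀ X : Game.{u}, X.IsImpartial → outcome (G + X) = outcome (H + X)

end Game

/-- The Nim heap of ordinal size `o`: either player may move to any heap of size less than `o`. -/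
noncomputable def heap (o : Ordinal.{u}) : Game.{u} :=
  .mk o.ToType o.ToType (fun i => heap (Ordinal.ToType.toOrd i).1)
    (fun i => heap (Ordinal.ToType.toOrd i).1)
termination_by o
decreasing_by all_goals exact (Ordinal.ToType.toOrd i).2

/-- The Transfinite Nim position with the given list of heap sizes (possibly including `0`). -/
noncomputable def nim (A : List Ordinal.{u}) : Game.{u} :=
  A.foldr (fun a G => heap a + G) 0

/-- An ordinal is odd if it is of the form `2 * m + 1`, that is, a limit ordinal or `0` plus an
odd natural number; otherwise it is even. -/
def OddSize (o : Ordinal.{u}) : Prop := o % 2 = 1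

noncomputable instance : DecidablePred OddSize.{u} := fun _ => Classical.propDecidable _

/-- `n ⊕ 1` for a single heap: size `n + 1` if `n` is even, `n - 1` if `n` is odd. -/
noncomputable def xorOne (n : Ordinal.{u}) : Ordinal.{u} :=
  if OddSize n then n.pred else n + 1

/-- Replace consecutive pairs of entries, from the lowest on, by entries one less, until at most
one entry is left. It is applied to the nondecreasing list of all odd heap sizes. -/
noncomputable def lowerPairs : List Ordinal.{u} → List Ordinal.{u}
  | a :: b :: l => a.pred :: b.pred :: lowerPairs l
  | l => l

/-- While there are two odd heaps, replace the lowest pair of them with heaps of size one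
less. -/
noncomputable def reduceOddPairs (s : Multiset Ordinal.{u}) : Multiset Ordinal.{u} :=
  s.filter (fun a => ¬ OddSize a) + (lowerPairs (s.filter (fun a => OddSize a)).sort : Multiset _)

/-- If there is a single odd heap and it is not the largest heap, replace it with a heap of size
one less and one of the largest heaps with a heap of size one greater. -/
noncomputable def moveOddToLargest (s : Multiset Ordinal.{u}) : Multiset Ordinal.{u} :=
  match (s.filter (fun a => OddSize a)).sort with
  | [a] => if a < s.sup then a.pred ::ₘ (s.sup + 1) ::ₘ (s.erase a).erase s.sup else s
  | _ => s

/-- The reduced form of a Nim position, as a nondecreasing list of nonzero heap sizes. -/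
noncomputable def reducedForm (A : List Ordinal.{u}) : List Ordinal.{u} :=
  ((moveOddToLargest (reduceOddPairs (A : Multiset Ordinal.{u}))).filter (fun a => a ≠ 0)).sort

end MisereNim

/-!
# Misère play, reversibility and Transfinite Nim

*The recursive tests.* Sufficiency of each test is an induction on the test game `X`: a winning
move in one sum is matched in the other one, or is answered by the reversing option. For necessity
one needs a test game that makes both players lose moving first in the appropriate sums
(`Game.exists_downlink` for the partizan order, `Game.exists_link` for impartial games). It is
assembled from test games that separate the options of `G` and `H` from the other game. Separating
games can be turned into the required form with the adjoint of a game `G`, a strategic inverse: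
whoever moves first in the sum of `G` and its adjoint loses (`Game.not_wins_add_adjoint`). For
impartial games the partizan order is symmetric, since they are isomorphic to their negatives, so
the test for the order gives the test for equality.

*Partizan classification of Nim.* Positions are treated as multisets of ordinals, up to zeros.
A position is determined by its set of options: at the largest heap size `c` where two positions
differ, the one with more heaps of size `c` has an option that the other one lacks
(`OptionsSubset.not_count_lt`). A reversible option would lead to a position `M`, two moves below
`N`, all of whose options are options of `N`. By `OptionsSubset.exists_step` then `M` is an option
of `N`, and the recursive test gives a contradiction to the well-foundedness of Nim. Hence equality
of Nim positions descends to their options, and an induction along the Dershowitz–Manna order of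
multisets shows that equal positions are isomorphic.

*Impartial classification of Nim.* A heap `2 * m + 1` is equivalent to heaps `2 * m` and `1`
(`heap_add_one_impEquiv`) and two heaps of size one cancel. So a position is determined, up to
impartial equivalence, by the nonzero halves `m` of its heaps and the parity of the number of odd
heaps (`nimClass`). Conversely the argument of the partizan case, applied to the halves, shows that
equivalent positions have the same invariant (`nimClass_eq_of_reversibleOrMatched`); the one
position that the recursion on options alone would identify with the empty position is two heaps of
size two (`eq_two_two_of_reversible`), which is excluded by its outcome. The reduced form preserves
the invariant and is determined by it (`reducedForm_spec`, `IsReduced.eq_of_nimClass_eq`).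
-/

namespace MisereNim

namespace Game

/-! ### Options and isomorphism -/

theorem left_mem_options {G x : Game.{u}} (hx : x ∈ G.leftOptions) : x ∈ G.options := Or.inl hx

theorem right_mem_options {G x : Game.{u}} (hx : x ∈ G.rightOptions) : x ∈ G.options := Or.inr hx

@[elab_as_elim]
theorem options_induction {P : Game.{u} → Prop} (G : Game.{u})
    (h : ∀ G : Game.{u}, (∀ x ∈ G.leftOptions, P x) → (∀ x ∈ G.rightOptions, P x) → P G) :
    P G := by
  induction G with
  | mk α β L R ihL ihR =>
    apply h
    · rintro _ ⟨i, rfl⟩; exact ihL i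
    · rintro _ ⟨j, rfl⟩; exact ihR j

@[simp]
theorem leftOptions_zero : (0 : Game.{u}).leftOptions = ∅ :=
  Set.range_eq_empty _

@[simp]
theorem rightOptions_zero : (0 : Game.{u}).rightOptions = ∅ :=
  Set.range_eq_empty _

theorem mem_leftOptions_add {G H x : Game.{u}} :
    x ∈ (G + H).leftOptions ↔
      (∃ y ∈ G.leftOptions, x = y + H) ∨ ∃ y ∈ H.leftOptions, x = G + y := by
  cases G; cases H
  rw [mk_add_mk]
  simp [leftOptions, eq_comm]

theorem mem_rightOptions_add {G H x : Game.{u}} :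
    x ∈ (G + H).rightOptions ↔
      (∃ y ∈ G.rightOptions, x = y + H) ∨ ∃ y ∈ H.rightOptions, x = G + y := by
  cases G; cases H
  rw [mk_add_mk]
  simp [rightOptions, eq_comm]

theorem add_mem_leftOptions_left {G y : Game.{u}} (h : y ∈ G.leftOptions) (H : Game.{u}) :
    y + H ∈ (G + H).leftOptions :=
  mem_leftOptions_add.2 (Or.inl ⟨y, h, rfl⟩)

theorem add_mem_leftOptions_right {H y : Game.{u}} (h : y ∈ H.leftOptions) (G : Game.{u}) :
    G + y ∈ (G + H).leftOptions :=
  mem_leftOptions_add.2 (Or.inr ⟨y, h, rfl⟩)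

theorem add_mem_rightOptions_left {G y : Game.{u}} (h : y ∈ G.rightOptions) (H : Game.{u}) :
    y + H ∈ (G + H).rightOptions :=
  mem_rightOptions_add.2 (Or.inl ⟨y, h, rfl⟩)

theorem add_mem_rightOptions_right {H y : Game.{u}} (h : y ∈ H.rightOptions) (G : Game.{u}) :
    G + y ∈ (G + H).rightOptions :=
  mem_rightOptions_add.2 (Or.inr ⟨y, h, rfl⟩)

theorem iso_iff {G H : Game.{u}} :
    Iso G H ↔
      (∀ x ∈ G.leftOptions, ∃ y ∈ H.leftOptions, Iso x y) ∧
      (∀ y ∈ H.leftOptions, ∃ x ∈ G.leftOptions, Iso x y) ∧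
      (∀ x ∈ G.rightOptions, ∃ y ∈ H.rightOptions, Iso x y) ∧
      (∀ y ∈ H.rightOptions, ∃ x ∈ G.rightOptions, Iso x y) := by
  cases G; cases H
  simp [Iso, leftOptions, rightOptions]

theorem Iso.refl (G : Game.{u}) : Iso G G := by
  induction G using options_induction with
  | _ G ihL ihR =>
    exact iso_iff.2 ⟨fun x hx => ⟨x, hx, ihL x hx⟩, fun x hx => ⟨x, hx, ihL x hx⟩,
      fun x hx => ⟨x, hx, ihR x hx⟩, fun x hx => ⟨x, hx, ihR x hx⟩⟩

theorem Iso.symm {G H : Game.{u}} (h : Iso G H) : Iso H G := by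
  induction G using options_induction generalizing H with
  | _ G ihL ihR =>
    obtain ⟨h1, h2, h3, h4⟩ := iso_iff.1 h
    refine iso_iff.2 ⟨fun y hy => ?_, fun x hx => ?_, fun y hy => ?_, fun x hx => ?_⟩
    · obtain ⟨x, hx, hxy⟩ := h2 y hy; exact ⟨x, hx, ihL x hx hxy⟩
    · obtain ⟨y, hy, hxy⟩ := h1 x hx; exact ⟨y, hy, ihL x hx hxy⟩
    · obtain ⟨x, hx, hxy⟩ := h4 y hy; exact ⟨x, hx, ihR x hx hxy⟩
    · obtain ⟨y, hy, hxy⟩ := h3 x hx; exact ⟨y, hy, ihR x hx hxy⟩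

theorem Iso.trans {G H K : Game.{u}} (h : Iso G H) (h' : Iso H K) : Iso G K := by
  induction G using options_induction generalizing H K with
  | _ G ihL ihR =>
    obtain ⟨h1, h2, h3, h4⟩ := iso_iff.1 h
    obtain ⟨k1, k2, k3, k4⟩ := iso_iff.1 h'
    refine iso_iff.2 ⟨fun x hx => ?_, fun z hz => ?_, fun x hx => ?_, fun z hz => ?_⟩
    · obtain ⟨y, hy, hxy⟩ := h1 x hx
      obtain ⟨z, hz, hyz⟩ := k1 y hy
      exact ⟨z, hz, ihL x hx hxy hyz⟩
    · obtain ⟨y, hy, hyz⟩ := k2 z hz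
      obtain ⟨x, hx, hxy⟩ := h2 y hy
      exact ⟨x, hx, ihL x hx hxy hyz⟩
    · obtain ⟨y, hy, hxy⟩ := h3 x hx
      obtain ⟨z, hz, hyz⟩ := k3 y hy
      exact ⟨z, hz, ihR x hx hxy hyz⟩
    · obtain ⟨y, hy, hyz⟩ := k4 z hz
      obtain ⟨x, hx, hxy⟩ := h4 y hy
      exact ⟨x, hx, ihR x hx hxy hyz⟩

theorem iso_zero_iff {G : Game.{u}} : Iso G 0 ↔ G.leftOptions = ∅ ∧ G.rightOptions = ∅ := by
  rw [iso_iff]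
  simp [Set.eq_empty_iff_forall_notMem]

/-! ### Sums up to isomorphism -/

theorem Iso.add {G G' H H' : Game.{u}} (hG : Iso G G') (hH : Iso H H') :
    Iso (G + H) (G' + H') := by
  induction G using options_induction generalizing G' H H' with
  | _ G ihGL ihGR =>
  induction H using options_induction generalizing H' with
  | _ H ihHL ihHR =>
    obtain ⟨h1, h2, h3, h4⟩ := iso_iff.1 hG
    obtain ⟨k1, k2, k3, k4⟩ := iso_iff.1 hH
    refine iso_iff.2 ⟨fun x hx => ?_, fun z hz => ?_, fun x hx => ?_, fun z hz => ?_⟩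
    · rcases mem_leftOptions_add.1 hx with ⟨y, hy, rfl⟩ | ⟨y, hy, rfl⟩
      · obtain ⟨z, hz, hyz⟩ := h1 y hy
        exact ⟨_, add_mem_leftOptions_left hz _, ihGL y hy hyz hH⟩
      · obtain ⟨z, hz, hyz⟩ := k1 y hy
        exact ⟨_, add_mem_leftOptions_right hz _, ihHL y hy hyz⟩
    · rcases mem_leftOptions_add.1 hz with ⟨y, hy, rfl⟩ | ⟨y, hy, rfl⟩
      · obtain ⟨x, hx, hxy⟩ := h2 y hy
        exact ⟨_, add_mem_leftOptions_left hx _, ihGL x hx hxy hH⟩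
      · obtain ⟨x, hx, hxy⟩ := k2 y hy
        exact ⟨_, add_mem_leftOptions_right hx _, ihHL x hx hxy⟩
    · rcases mem_rightOptions_add.1 hx with ⟨y, hy, rfl⟩ | ⟨y, hy, rfl⟩
      · obtain ⟨z, hz, hyz⟩ := h3 y hy
        exact ⟨_, add_mem_rightOptions_left hz _, ihGR y hy hyz hH⟩
      · obtain ⟨z, hz, hyz⟩ := k3 y hy
        exact ⟨_, add_mem_rightOptions_right hz _, ihHR y hy hyz⟩
    · rcases mem_rightOptions_add.1 hz with ⟨y, hy, rfl⟩ | ⟨y, hy, rfl⟩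
      · obtain ⟨x, hx, hxy⟩ := h4 y hy
        exact ⟨_, add_mem_rightOptions_left hx _, ihGR x hx hxy hH⟩
      · obtain ⟨x, hx, hxy⟩ := k4 y hy
        exact ⟨_, add_mem_rightOptions_right hx _, ihHR x hx hxy⟩

theorem add_comm_iso (G H : Game.{u}) : Iso (G + H) (H + G) := by
  induction G using options_induction generalizing H with
  | _ G ihGL ihGR =>
  induction H using options_induction with
  | _ H ihHL ihHR =>
    refine iso_iff.2 ⟨fun x hx => ?_, fun z hz => ?_, fun x hx => ?_, fun z hz => ?_⟩
    · rcases mem_leftOptions_add.1 hx with ⟨y, hy, rfl⟩ | ⟨y, hy, rfl⟩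
      · exact ⟨_, add_mem_leftOptions_right hy _, ihGL y hy H⟩
      · exact ⟨_, add_mem_leftOptions_left hy _, ihHL y hy⟩
    · rcases mem_leftOptions_add.1 hz with ⟨y, hy, rfl⟩ | ⟨y, hy, rfl⟩
      · exact ⟨_, add_mem_leftOptions_right hy _, ihHL y hy⟩
      · exact ⟨_, add_mem_leftOptions_left hy _, ihGL y hy H⟩
    · rcases mem_rightOptions_add.1 hx with ⟨y, hy, rfl⟩ | ⟨y, hy, rfl⟩
      · exact ⟨_, add_mem_rightOptions_right hy _, ihGR y hy H⟩
      · exact ⟨_, add_mem_rightOptions_left hy _, ihHR y hy⟩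
    · rcases mem_rightOptions_add.1 hz with ⟨y, hy, rfl⟩ | ⟨y, hy, rfl⟩
      · exact ⟨_, add_mem_rightOptions_right hy _, ihHR y hy⟩
      · exact ⟨_, add_mem_rightOptions_left hy _, ihGR y hy H⟩

theorem add_assoc_iso (G H K : Game.{u}) : Iso (G + H + K) (G + (H + K)) := by
  induction G using options_induction generalizing H K with
  | _ G ihGL ihGR =>
  induction H using options_induction generalizing K with
  | _ H ihHL ihHR =>
  induction K using options_induction with
  | _ K ihKL ihKR =>
    refine iso_iff.2 ⟨fun x hx => ?_, fun z hz => ?_, fun x hx => ?_, fun z hz => ?_⟩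
    · rcases mem_leftOptions_add.1 hx with ⟨w, hw, rfl⟩ | ⟨y, hy, rfl⟩
      · rcases mem_leftOptions_add.1 hw with ⟨y, hy, rfl⟩ | ⟨y, hy, rfl⟩
        · exact ⟨_, add_mem_leftOptions_left hy _, ihGL y hy H K⟩
        · exact ⟨_, add_mem_leftOptions_right (add_mem_leftOptions_left hy _) _, ihHL y hy K⟩
      · exact ⟨_, add_mem_leftOptions_right (add_mem_leftOptions_right hy _) _, ihKL y hy⟩
    · rcases mem_leftOptions_add.1 hz with ⟨y, hy, rfl⟩ | ⟨w, hw, rfl⟩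
      · exact ⟨_, add_mem_leftOptions_left (add_mem_leftOptions_left hy _) _, ihGL y hy H K⟩
      · rcases mem_leftOptions_add.1 hw with ⟨y, hy, rfl⟩ | ⟨y, hy, rfl⟩
        · exact ⟨_, add_mem_leftOptions_left (add_mem_leftOptions_right hy _) _, ihHL y hy K⟩
        · exact ⟨_, add_mem_leftOptions_right hy _, ihKL y hy⟩
    · rcases mem_rightOptions_add.1 hx with ⟨w, hw, rfl⟩ | ⟨y, hy, rfl⟩
      · rcases mem_rightOptions_add.1 hw with ⟨y, hy, rfl⟩ | ⟨y, hy, rfl⟩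
        · exact ⟨_, add_mem_rightOptions_left hy _, ihGR y hy H K⟩
        · exact ⟨_, add_mem_rightOptions_right (add_mem_rightOptions_left hy _) _, ihHR y hy K⟩
      · exact ⟨_, add_mem_rightOptions_right (add_mem_rightOptions_right hy _) _, ihKR y hy⟩
    · rcases mem_rightOptions_add.1 hz with ⟨y, hy, rfl⟩ | ⟨w, hw, rfl⟩
      · exact ⟨_, add_mem_rightOptions_left (add_mem_rightOptions_left hy _) _, ihGR y hy H K⟩
      · rcases mem_rightOptions_add.1 hw with ⟨y, hy, rfl⟩ | ⟨y, hy, rfl⟩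
        · exact ⟨_, add_mem_rightOptions_left (add_mem_rightOptions_right hy _) _, ihHR y hy K⟩
        · exact ⟨_, add_mem_rightOptions_right hy _, ihKR y hy⟩

theorem add_zero_iso (G : Game.{u}) : Iso (G + 0) G := by
  induction G using options_induction with
  | _ G ihL ihR =>
    refine iso_iff.2 ⟨fun x hx => ?_, fun y hy => ⟨_, add_mem_leftOptions_left hy _, ihL y hy⟩,
      fun x hx => ?_, fun y hy => ⟨_, add_mem_rightOptions_left hy _, ihR y hy⟩⟩
    · rcases mem_leftOptions_add.1 hx with ⟨y, hy, rfl⟩ | ⟨y, hy, rfl⟩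
      · exact ⟨y, hy, ihL y hy⟩
      · simp at hy
    · rcases mem_rightOptions_add.1 hx with ⟨y, hy, rfl⟩ | ⟨y, hy, rfl⟩
      · exact ⟨y, hy, ihR y hy⟩
      · simp at hy

theorem zero_add_iso (G : Game.{u}) : Iso (0 + G) G :=
  (add_comm_iso 0 G).trans (add_zero_iso G)

/-! ### Misère play -/

/-- Left wins `G` under misère play when moving first. -/
def LeftWins (G : Game.{u}) : Prop := G.winsFirst.1

/-- Right wins `G` under misère play when moving first. -/
def RightWins (G : Game.{u}) : Prop := G.winsFirst.2

theorem leftWins_iff {G : Game.{u}} :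
    G.LeftWins ↔ G.leftOptions = ∅ ∨ ∃ x ∈ G.leftOptions, ¬ x.RightWins := by
  cases G
  simp [LeftWins, RightWins, winsFirst, leftOptions, Set.range_eq_empty_iff]

theorem rightWins_iff {G : Game.{u}} :
    G.RightWins ↔ G.rightOptions = ∅ ∨ ∃ x ∈ G.rightOptions, ¬ x.LeftWins := by
  cases G
  simp [LeftWins, RightWins, winsFirst, rightOptions, Set.range_eq_empty_iff]

theorem leftWins_of_mem {G x : Game.{u}} (hx : x ∈ G.leftOptions) (h : ¬ x.RightWins) :
    G.LeftWins :=
  leftWins_iff.2 (Or.inr ⟨x, hx, h⟩)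

theorem rightWins_of_mem {G x : Game.{u}} (hx : x ∈ G.rightOptions) (h : ¬ x.LeftWins) :
    G.RightWins :=
  rightWins_iff.2 (Or.inr ⟨x, hx, h⟩)

theorem not_leftWins_iff {G : Game.{u}} :
    ¬ G.LeftWins ↔ G.leftOptions.Nonempty ∧ ∀ x ∈ G.leftOptions, x.RightWins := by
  rw [leftWins_iff, Set.nonempty_iff_ne_empty]
  push Not
  rfl

theorem not_rightWins_iff {G : Game.{u}} :
    ¬ G.RightWins ↔ G.rightOptions.Nonempty ∧ ∀ x ∈ G.rightOptions, x.LeftWins := by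
  rw [rightWins_iff, Set.nonempty_iff_ne_empty]
  push Not
  rfl

theorem Iso.leftOptions_eq_empty_iff {G H : Game.{u}} (h : Iso G H) :
    G.leftOptions = ∅ ↔ H.leftOptions = ∅ := by
  obtain ⟨h1, h2, -, -⟩ := iso_iff.1 h
  simp only [Set.eq_empty_iff_forall_notMem]
  exact ⟨fun e y hy => let ⟨x, hx, _⟩ := h2 y hy; e x hx,
    fun e x hx => let ⟨y, hy, _⟩ := h1 x hx; e y hy⟩

theorem Iso.rightOptions_eq_empty_iff {G H : Game.{u}} (h : Iso G H) :
    G.rightOptions = ∅ ↔ H.rightOptions = ∅ := by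
  obtain ⟨-, -, h1, h2⟩ := iso_iff.1 h
  simp only [Set.eq_empty_iff_forall_notMem]
  exact ⟨fun e y hy => let ⟨x, hx, _⟩ := h2 y hy; e x hx,
    fun e x hx => let ⟨y, hy, _⟩ := h1 x hx; e y hy⟩

theorem Iso.wins_iff {G H : Game.{u}} (h : Iso G H) :
    (G.LeftWins ↔ H.LeftWins) ∧ (G.RightWins ↔ H.RightWins) := by
  induction G using options_induction generalizing H with
  | _ G ihL ihR =>
    obtain ⟨h1, h2, h3, h4⟩ := iso_iff.1 h
    constructor
    · rw [leftWins_iff, leftWins_iff, h.leftOptions_eq_empty_iff]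
      refine or_congr Iff.rfl ⟨?_, ?_⟩
      · rintro ⟨x, hx, hw⟩
        obtain ⟨y, hy, hxy⟩ := h1 x hx
        exact ⟨y, hy, fun h => hw ((ihL x hx hxy).2.2 h)⟩
      · rintro ⟨y, hy, hw⟩
        obtain ⟨x, hx, hxy⟩ := h2 y hy
        exact ⟨x, hx, fun h => hw ((ihL x hx hxy).2.1 h)⟩
    · rw [rightWins_iff, rightWins_iff, h.rightOptions_eq_empty_iff]
      refine or_congr Iff.rfl ⟨?_, ?_⟩
      · rintro ⟨x, hx, hw⟩
        obtain ⟨y, hy, hxy⟩ := h3 x hx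
        exact ⟨y, hy, fun h => hw ((ihR x hx hxy).1.2 h)⟩
      · rintro ⟨y, hy, hw⟩
        obtain ⟨x, hx, hxy⟩ := h4 y hy
        exact ⟨x, hx, fun h => hw ((ihR x hx hxy).1.1 h)⟩

theorem Iso.leftWins_iff {G H : Game.{u}} (h : Iso G H) : G.LeftWins ↔ H.LeftWins :=
  h.wins_iff.1

theorem outcome_le_iff {G H : Game.{u}} :
    outcome H ≤ outcome G ↔ (H.LeftWins → G.LeftWins) ∧ (G.RightWins → H.RightWins) := by
  change (_ = _ ∨ _ = _ ∨ _ = _) ↔ _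
  unfold LeftWins RightWins outcome
  split_ifs <;> simp_all

theorem outcome_eq_iff {G H : Game.{u}} :
    outcome G = outcome H ↔ (G.LeftWins ↔ H.LeftWins) ∧ (G.RightWins ↔ H.RightWins) := by
  unfold LeftWins RightWins outcome
  split_ifs <;> simp_all

theorem outcome_eq_N_iff {G : Game.{u}} : outcome G = .N ↔ G.LeftWins ∧ G.RightWins := by
  unfold LeftWins RightWins outcome
  split_ifs <;> simp_all

theorem geq_iff {G H : Game.{u}} :
    Geq G H ↔ ∀ X : Game.{u}, ((H + X).LeftWins → (G + X).LeftWins) ∧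
      ((G + X).RightWins → (H + X).RightWins) :=
  forall_congr' fun _ => outcome_le_iff

theorem Geq.leftWins {G H : Game.{u}} (h : Geq G H) {X : Game.{u}} (hX : (H + X).LeftWins) :
    (G + X).LeftWins :=
  (geq_iff.1 h X).1 hX

theorem Geq.rightWins {G H : Game.{u}} (h : Geq G H) {X : Game.{u}} (hX : (G + X).RightWins) :
    (H + X).RightWins :=
  (geq_iff.1 h X).2 hX

/-! ### Impartial games -/

theorem isImpartial_iff {G : Game.{u}} :
    G.IsImpartial ↔
      (∀ x ∈ G.leftOptions, ∃ y ∈ G.rightOptions, Iso x y) ∧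
      (∀ y ∈ G.rightOptions, ∃ x ∈ G.leftOptions, Iso x y) ∧
      (∀ x ∈ G.leftOptions, x.IsImpartial) ∧ (∀ y ∈ G.rightOptions, y.IsImpartial) := by
  cases G
  simp [IsImpartial, leftOptions, rightOptions]

theorem IsImpartial.exists_right {G : Game.{u}} (h : G.IsImpartial) {x : Game.{u}}
    (hx : x ∈ G.leftOptions) : ∃ y ∈ G.rightOptions, Iso x y :=
  (isImpartial_iff.1 h).1 x hx

theorem IsImpartial.exists_left {G : Game.{u}} (h : G.IsImpartial) {y : Game.{u}}
    (hy : y ∈ G.rightOptions) : ∃ x ∈ G.leftOptions, Iso x y :=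
  (isImpartial_iff.1 h).2.1 y hy

theorem IsImpartial.of_left {G : Game.{u}} (h : G.IsImpartial) {x : Game.{u}}
    (hx : x ∈ G.leftOptions) : x.IsImpartial :=
  (isImpartial_iff.1 h).2.2.1 x hx

theorem IsImpartial.of_right {G : Game.{u}} (h : G.IsImpartial) {x : Game.{u}}
    (hx : x ∈ G.rightOptions) : x.IsImpartial :=
  (isImpartial_iff.1 h).2.2.2 x hx

theorem IsImpartial.of_option {G : Game.{u}} (h : G.IsImpartial) {x : Game.{u}}
    (hx : x ∈ G.options) : x.IsImpartial :=
  hx.elim h.of_left h.of_right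

theorem IsImpartial.exists_left_of_option {G : Game.{u}} (h : G.IsImpartial) {x : Game.{u}}
    (hx : x ∈ G.options) : ∃ y ∈ G.leftOptions, Iso y x :=
  hx.elim (fun hx => ⟨x, hx, Iso.refl x⟩) h.exists_left

theorem IsImpartial.rightOptions_eq_empty_iff {G : Game.{u}} (h : G.IsImpartial) :
    G.rightOptions = ∅ ↔ G.leftOptions = ∅ := by
  simp only [Set.eq_empty_iff_forall_notMem]
  exact ⟨fun e x hx => let ⟨y, hy, _⟩ := h.exists_right hx; e y hy,
    fun e y hy => let ⟨x, hx, _⟩ := h.exists_left hy; e x hx⟩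

theorem IsImpartial.iso_zero_iff {G : Game.{u}} (h : G.IsImpartial) :
    Iso G 0 ↔ G.leftOptions = ∅ := by
  rw [Game.iso_zero_iff, h.rightOptions_eq_empty_iff, and_self]

theorem isImpartial_zero : (0 : Game.{u}).IsImpartial := by
  rw [isImpartial_iff]; simp

theorem IsImpartial.add {G H : Game.{u}} (hG : G.IsImpartial) (hH : H.IsImpartial) :
    (G + H).IsImpartial := by
  induction G using options_induction generalizing H with
  | _ G ihGL ihGR =>
  induction H using options_induction with
  | _ H ihHL ihHR =>
    refine isImpartial_iff.2 ⟨fun x hx => ?_, fun x hx => ?_, fun x hx => ?_, fun x hx => ?_⟩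
    · rcases mem_leftOptions_add.1 hx with ⟨y, hy, rfl⟩ | ⟨y, hy, rfl⟩
      · obtain ⟨z, hz, hyz⟩ := hG.exists_right hy
        exact ⟨_, add_mem_rightOptions_left hz _, hyz.add (Iso.refl _)⟩
      · obtain ⟨z, hz, hyz⟩ := hH.exists_right hy
        exact ⟨_, add_mem_rightOptions_right hz _, (Iso.refl _).add hyz⟩
    · rcases mem_rightOptions_add.1 hx with ⟨y, hy, rfl⟩ | ⟨y, hy, rfl⟩
      · obtain ⟨z, hz, hyz⟩ := hG.exists_left hy
        exact ⟨_, add_mem_leftOptions_left hz _, hyz.add (Iso.refl _)⟩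
      · obtain ⟨z, hz, hyz⟩ := hH.exists_left hy
        exact ⟨_, add_mem_leftOptions_right hz _, (Iso.refl _).add hyz⟩
    · rcases mem_leftOptions_add.1 hx with ⟨y, hy, rfl⟩ | ⟨y, hy, rfl⟩
      · exact ihGL y hy (hG.of_left hy) hH
      · exact ihHL y hy (hH.of_left hy)
    · rcases mem_rightOptions_add.1 hx with ⟨y, hy, rfl⟩ | ⟨y, hy, rfl⟩
      · exact ihGR y hy (hG.of_right hy) hH
      · exact ihHR y hy (hH.of_right hy)

theorem IsImpartial.rightWins_iff {G : Game.{u}} (h : G.IsImpartial) :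
    G.RightWins ↔ G.LeftWins := by
  induction G using options_induction with
  | _ G ihL ihR =>
    rw [Game.rightWins_iff, Game.leftWins_iff, h.rightOptions_eq_empty_iff]
    refine or_congr Iff.rfl ⟨?_, ?_⟩
    · rintro ⟨y, hy, hw⟩
      obtain ⟨x, hx, hxy⟩ := h.exists_left hy
      exact ⟨x, hx, fun hr => hw (hxy.leftWins_iff.1 ((ihL x hx (h.of_left hx)).1 hr))⟩
    · rintro ⟨x, hx, hw⟩
      obtain ⟨y, hy, hxy⟩ := h.exists_right hx
      exact ⟨y, hy, fun hl => hw ((ihL x hx (h.of_left hx)).2 (hxy.leftWins_iff.2 hl))⟩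

theorem IsImpartial.leftWins_iff {G : Game.{u}} (h : G.IsImpartial) :
    G.LeftWins ↔ G.leftOptions = ∅ ∨ ∃ x ∈ G.leftOptions, ¬ x.LeftWins := by
  rw [Game.leftWins_iff]
  refine or_congr Iff.rfl (exists_congr fun x => and_congr_right fun hx => not_congr ?_)
  exact (h.of_left hx).rightWins_iff

theorem IsImpartial.leftWins_of_mem {G x : Game.{u}} (h : G.IsImpartial) (hx : x ∈ G.leftOptions)
    (hw : ¬ x.LeftWins) : G.LeftWins :=
  h.leftWins_iff.2 (Or.inr ⟨x, hx, hw⟩)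

theorem IsImpartial.not_leftWins_iff {G : Game.{u}} (h : G.IsImpartial) :
    ¬ G.LeftWins ↔ G.leftOptions.Nonempty ∧ ∀ x ∈ G.leftOptions, x.LeftWins := by
  rw [h.leftWins_iff, Set.nonempty_iff_ne_empty]
  push Not
  rfl

theorem IsImpartial.outcome_eq_iff {G H : Game.{u}} (hG : G.IsImpartial) (hH : H.IsImpartial) :
    outcome G = outcome H ↔ (G.LeftWins ↔ H.LeftWins) := by
  rw [Game.outcome_eq_iff, hG.rightWins_iff, hH.rightWins_iff, and_self]

theorem IsImpartial.outcome_eq_N_iff {G : Game.{u}} (hG : G.IsImpartial) :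
    outcome G = .N ↔ G.LeftWins := by
  rw [Game.outcome_eq_N_iff, hG.rightWins_iff, and_self]

theorem impEquiv_iff {G H : Game.{u}} (hG : G.IsImpartial) (hH : H.IsImpartial) :
    ImpEquiv G H ↔ ∀ X : Game.{u}, X.IsImpartial → ((G + X).LeftWins ↔ (H + X).LeftWins) :=
  forall₂_congr fun _ hX => (hG.add hX).outcome_eq_iff (hH.add hX)

theorem ImpEquiv.symm {G H : Game.{u}} (h : ImpEquiv G H) : ImpEquiv H G :=
  fun X hX => (h X hX).symm

theorem ImpEquiv.trans {G H K : Game.{u}} (h : ImpEquiv G H) (h' : ImpEquiv H K) :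
    ImpEquiv G K :=
  fun X hX => (h X hX).trans (h' X hX)

theorem Iso.outcome_eq {G H : Game.{u}} (h : Iso G H) : outcome G = outcome H :=
  outcome_eq_iff.2 h.wins_iff

theorem Iso.impEquiv {G H : Game.{u}} (h : Iso G H) : ImpEquiv G H :=
  fun X _ => (h.add (Iso.refl X)).outcome_eq

theorem ImpEquiv.add_right {G H K : Game.{u}} (h : ImpEquiv G H) (hK : K.IsImpartial) :
    ImpEquiv (G + K) (H + K) := fun X hX => by
  rw [(add_assoc_iso G K X).outcome_eq, (add_assoc_iso H K X).outcome_eq]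
  exact h _ (hK.add hX)

theorem ImpEquiv.add_left {G H K : Game.{u}} (h : ImpEquiv G H) (hK : K.IsImpartial) :
    ImpEquiv (K + G) (K + H) :=
  (add_comm_iso K G).impEquiv.trans ((h.add_right hK).trans (add_comm_iso H K).impEquiv)

theorem Geq.trans {G H K : Game.{u}} (h : Geq G H) (h' : Geq H K) : Geq G K :=
  fun X => (h' X).trans (h X)

theorem Iso.geq {G H : Game.{u}} (h : Iso G H) : Geq G H :=
  fun X => (h.add (Iso.refl X)).outcome_eq.ge

theorem Iso.partEquiv {G H : Game.{u}} (h : Iso G H) : PartEquiv G H :=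
  ⟨h.geq, h.symm.geq⟩

theorem PartEquiv.symm {G H : Game.{u}} (h : PartEquiv G H) : PartEquiv H G :=
  ⟨h.2, h.1⟩

theorem PartEquiv.trans {G H K : Game.{u}} (h : PartEquiv G H) (h' : PartEquiv H K) :
    PartEquiv G K :=
  ⟨h.1.trans h'.1, h'.2.trans h.2⟩

/-! ### Negation -/

/-- The negative of a game: the roles of the players are exchanged. -/
def neg : Game.{u} → Game.{u}
  | mk α β L R => mk β α (fun j => neg (R j)) (fun i => neg (L i))

theorem mem_leftOptions_neg {G x : Game.{u}} :
    x ∈ G.neg.leftOptions ↔ ∃ y ∈ G.rightOptions, x = y.neg := by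
  cases G
  simp [neg, leftOptions, rightOptions, eq_comm]

theorem mem_rightOptions_neg {G x : Game.{u}} :
    x ∈ G.neg.rightOptions ↔ ∃ y ∈ G.leftOptions, x = y.neg := by
  cases G
  simp [neg, leftOptions, rightOptions, eq_comm]

@[simp]
theorem neg_neg (G : Game.{u}) : G.neg.neg = G := by
  induction G with
  | mk α β L R ihL ihR => simp only [neg, ihL, ihR]

theorem neg_add (G H : Game.{u}) : (G + H).neg = G.neg + H.neg := by
  induction G generalizing H with
  | mk α β L R ihL ihR =>
  induction H with
  | mk γ δ L' R' ihL' ihR' =>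
    rw [mk_add_mk]
    simp only [neg]
    rw [mk_add_mk]
    congr 1 <;> funext i <;> rcases i with i | i
    · exact ihR i _
    · exact ihR' i
    · exact ihL i _
    · exact ihL' i

theorem wins_neg_iff (G : Game.{u}) :
    (G.neg.LeftWins ↔ G.RightWins) ∧ (G.neg.RightWins ↔ G.LeftWins) := by
  induction G using options_induction with
  | _ G ihL ihR =>
    constructor
    · rw [leftWins_iff, rightWins_iff]
      simp only [Set.eq_empty_iff_forall_notMem, mem_leftOptions_neg]
      constructor
      · rintro (h | ⟨_, ⟨y, hy, rfl⟩, h⟩)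
        · exact Or.inl fun y hy => h _ ⟨y, hy, rfl⟩
        · exact Or.inr ⟨y, hy, fun hl => h ((ihR y hy).2.2 hl)⟩
      · rintro (h | ⟨y, hy, h⟩)
        · exact Or.inl fun x ⟨y, hy, _⟩ => h y hy
        · exact Or.inr ⟨_, ⟨y, hy, rfl⟩, fun hl => h ((ihR y hy).2.1 hl)⟩
    · rw [leftWins_iff, rightWins_iff]
      simp only [Set.eq_empty_iff_forall_notMem, mem_rightOptions_neg]
      constructor
      · rintro (h | ⟨_, ⟨y, hy, rfl⟩, h⟩)
        · exact Or.inl fun y hy => h _ ⟨y, hy, rfl⟩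
        · exact Or.inr ⟨y, hy, fun hl => h ((ihL y hy).1.2 hl)⟩
      · rintro (h | ⟨y, hy, h⟩)
        · exact Or.inl fun x ⟨y, hy, _⟩ => h y hy
        · exact Or.inr ⟨_, ⟨y, hy, rfl⟩, fun hl => h ((ihL y hy).1.1 hl)⟩

theorem leftWins_neg_add {G X : Game.{u}} : (G.neg + X).LeftWins ↔ (G + X.neg).RightWins := by
  rw [← (wins_neg_iff (G + X.neg)).1, neg_add, neg_neg]

theorem rightWins_neg_add {G X : Game.{u}} : (G.neg + X).RightWins ↔ (G + X.neg).LeftWins := by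
  rw [← (wins_neg_iff (G + X.neg)).2, neg_add, neg_neg]

theorem Geq.neg {G H : Game.{u}} (h : Geq G H) : Geq H.neg G.neg :=
  geq_iff.2 fun X => by
    rw [leftWins_neg_add, leftWins_neg_add, rightWins_neg_add, rightWins_neg_add]
    exact ⟨h.rightWins, h.leftWins⟩

theorem IsImpartial.neg_iso {G : Game.{u}} (h : G.IsImpartial) : Iso G.neg G := by
  induction G using options_induction with
  | _ G ihL ihR =>
    refine iso_iff.2 ⟨fun x hx => ?_, fun y hy => ?_, fun x hx => ?_, fun y hy => ?_⟩
    · obtain ⟨y, hy, rfl⟩ := mem_leftOptions_neg.1 hx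
      obtain ⟨z, hz, hzy⟩ := h.exists_left hy
      exact ⟨z, hz, (ihR y hy (h.of_right hy)).trans hzy.symm⟩
    · obtain ⟨z, hz, hyz⟩ := h.exists_right hy
      exact ⟨_, mem_leftOptions_neg.2 ⟨z, hz, rfl⟩, (ihR z hz (h.of_right hz)).trans hyz.symm⟩
    · obtain ⟨y, hy, rfl⟩ := mem_rightOptions_neg.1 hx
      obtain ⟨z, hz, hyz⟩ := h.exists_right hy
      exact ⟨z, hz, (ihL y hy (h.of_left hy)).trans hyz⟩
    · obtain ⟨z, hz, hzy⟩ := h.exists_left hy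
      exact ⟨_, mem_rightOptions_neg.2 ⟨z, hz, rfl⟩, (ihL z hz (h.of_left hz)).trans hzy⟩

/-- On impartial games the order `Geq` is symmetric, since impartial games are isomorphic to their
negatives. -/
theorem IsImpartial.geq_symm {G H : Game.{u}} (hG : G.IsImpartial) (hH : H.IsImpartial)
    (h : Geq G H) : Geq H G :=
  (hH.neg_iso.symm.geq.trans h.neg).trans hG.neg_iso.geq

/-! ### Games with prescribed sets of options -/

/-- The game whose sets of Left and Right options are the given small sets. -/
noncomputable def ofSets (s t : Set Game.{u}) [Small.{u} s] [Small.{u} t] : Game.{u} :=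
  mk (Shrink.{u} s) (Shrink.{u} t) (fun i => ((equivShrink s).symm i).1)
    (fun j => ((equivShrink t).symm j).1)

@[simp]
theorem leftOptions_ofSets (s t : Set Game.{u}) [Small.{u} s] [Small.{u} t] :
    (ofSets s t).leftOptions = s := by
  ext x
  constructor
  · rintro ⟨i, rfl⟩; exact ((equivShrink s).symm i).2
  · intro hx; exact ⟨equivShrink s ⟨x, hx⟩, by simp⟩

@[simp]
theorem rightOptions_ofSets (s t : Set Game.{u}) [Small.{u} s] [Small.{u} t] :
    (ofSets s t).rightOptions = t := by
  ext x
  constructor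
  · rintro ⟨i, rfl⟩; exact ((equivShrink t).symm i).2
  · intro hx; exact ⟨equivShrink t ⟨x, hx⟩, by simp⟩

instance small_leftOptions (G : Game.{u}) : Small.{u} G.leftOptions := by
  cases G; exact small_range _

instance small_rightOptions (G : Game.{u}) : Small.{u} G.rightOptions := by
  cases G; exact small_range _

theorem isImpartial_ofSets {s : Set Game.{u}} [Small.{u} s] (h : ∀ x ∈ s, x.IsImpartial) :
    (ofSets s s).IsImpartial := by
  rw [isImpartial_iff, leftOptions_ofSets, rightOptions_ofSets]
  exact ⟨fun x hx => ⟨x, hx, Iso.refl x⟩, fun x hx => ⟨x, hx, Iso.refl x⟩, h, h⟩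

/-! ### The adjoint -/

/-- The misère adjoint of `G`: the negative of `G` in which, recursively, a player without moves
gets a single move to `0`. It plays the role of an inverse: whoever moves first in the sum of `G`
and its adjoint loses. -/
def adjoint : Game.{u} → Game.{u}
  | mk α β L R =>
    mk (β ⊕ ULift.{u} (PLift (IsEmpty β))) (α ⊕ ULift.{u} (PLift (IsEmpty α)))
      (Sum.elim (fun j => adjoint (R j)) (fun _ => 0))
      (Sum.elim (fun i => adjoint (L i)) (fun _ => 0))

theorem mem_leftOptions_adjoint {G x : Game.{u}} :
    x ∈ G.adjoint.leftOptions ↔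
      (∃ y ∈ G.rightOptions, x = y.adjoint) ∨ (G.rightOptions = ∅ ∧ x = 0) := by
  cases G
  simp [adjoint, leftOptions, rightOptions, Set.range_eq_empty_iff, @eq_comm _ x]

theorem mem_rightOptions_adjoint {G x : Game.{u}} :
    x ∈ G.adjoint.rightOptions ↔
      (∃ y ∈ G.leftOptions, x = y.adjoint) ∨ (G.leftOptions = ∅ ∧ x = 0) := by
  cases G
  simp [adjoint, leftOptions, rightOptions, Set.range_eq_empty_iff, @eq_comm _ x]

theorem adjoint_mem_leftOptions {G y : Game.{u}} (hy : y ∈ G.rightOptions) :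
    y.adjoint ∈ G.adjoint.leftOptions :=
  mem_leftOptions_adjoint.2 (Or.inl ⟨y, hy, rfl⟩)

theorem adjoint_mem_rightOptions {G y : Game.{u}} (hy : y ∈ G.leftOptions) :
    y.adjoint ∈ G.adjoint.rightOptions :=
  mem_rightOptions_adjoint.2 (Or.inl ⟨y, hy, rfl⟩)

theorem leftOptions_adjoint_nonempty (G : Game.{u}) : G.adjoint.leftOptions.Nonempty := by
  rcases G.rightOptions.eq_empty_or_nonempty with h | ⟨y, hy⟩
  · exact ⟨0, mem_leftOptions_adjoint.2 (Or.inr ⟨h, rfl⟩)⟩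
  · exact ⟨_, adjoint_mem_leftOptions hy⟩

theorem rightOptions_adjoint_nonempty (G : Game.{u}) : G.adjoint.rightOptions.Nonempty := by
  rcases G.leftOptions.eq_empty_or_nonempty with h | ⟨y, hy⟩
  · exact ⟨0, mem_rightOptions_adjoint.2 (Or.inr ⟨h, rfl⟩)⟩
  · exact ⟨_, adjoint_mem_rightOptions hy⟩

theorem rightWins_add_zero {G : Game.{u}} (h : G.rightOptions = ∅) : (G + 0).RightWins :=
  rightWins_iff.2 (Or.inl ((add_zero_iso G).rightOptions_eq_empty_iff.2 h))

theorem leftWins_add_zero {G : Game.{u}} (h : G.leftOptions = ∅) : (G + 0).LeftWins :=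
  leftWins_iff.2 (Or.inl ((add_zero_iso G).leftOptions_eq_empty_iff.2 h))

theorem not_wins_add_adjoint (G : Game.{u}) :
    ¬ (G + G.adjoint).LeftWins ∧ ¬ (G + G.adjoint).RightWins := by
  induction G using options_induction with
  | _ G ihL ihR =>
    constructor
    · refine not_leftWins_iff.2 ⟨?_, fun x hx => ?_⟩
      · obtain ⟨z, hz⟩ := leftOptions_adjoint_nonempty G
        exact ⟨_, add_mem_leftOptions_right hz G⟩
      · rcases mem_leftOptions_add.1 hx with ⟨y, hy, rfl⟩ | ⟨z, hz, rfl⟩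
        · exact rightWins_of_mem (add_mem_rightOptions_right (adjoint_mem_rightOptions hy) _)
            (ihL y hy).1
        · rcases mem_leftOptions_adjoint.1 hz with ⟨y, hy, rfl⟩ | ⟨h, rfl⟩
          · exact rightWins_of_mem (add_mem_rightOptions_left hy _) (ihR y hy).1
          · exact rightWins_add_zero h
    · refine not_rightWins_iff.2 ⟨?_, fun x hx => ?_⟩
      · obtain ⟨z, hz⟩ := rightOptions_adjoint_nonempty G
        exact ⟨_, add_mem_rightOptions_right hz G⟩
      · rcases mem_rightOptions_add.1 hx with ⟨y, hy, rfl⟩ | ⟨z, hz, rfl⟩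
        · exact leftWins_of_mem (add_mem_leftOptions_right (adjoint_mem_leftOptions hy) _)
            (ihR y hy).2
        · rcases mem_rightOptions_adjoint.1 hz with ⟨y, hy, rfl⟩ | ⟨h, rfl⟩
          · exact leftWins_of_mem (add_mem_leftOptions_left hy _) (ihL y hy).2
          · exact leftWins_add_zero h

theorem Iso.adjoint {G H : Game.{u}} (h : Iso G H) : Iso G.adjoint H.adjoint := by
  induction G using options_induction generalizing H with
  | _ G ihL ihR =>
    obtain ⟨h1, h2, h3, h4⟩ := iso_iff.1 h
    refine iso_iff.2 ⟨fun x hx => ?_, fun z hz => ?_, fun x hx => ?_, fun z hz => ?_⟩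
    · rcases mem_leftOptions_adjoint.1 hx with ⟨y, hy, rfl⟩ | ⟨he, rfl⟩
      · obtain ⟨z, hz, hyz⟩ := h3 y hy
        exact ⟨_, adjoint_mem_leftOptions hz, ihR y hy hyz⟩
      · exact ⟨0, mem_leftOptions_adjoint.2
          (Or.inr ⟨h.rightOptions_eq_empty_iff.1 he, rfl⟩), Iso.refl 0⟩
    · rcases mem_leftOptions_adjoint.1 hz with ⟨y, hy, rfl⟩ | ⟨he, rfl⟩
      · obtain ⟨x, hx, hxy⟩ := h4 y hy
        exact ⟨_, adjoint_mem_leftOptions hx, ihR x hx hxy⟩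
      · exact ⟨0, mem_leftOptions_adjoint.2
          (Or.inr ⟨h.rightOptions_eq_empty_iff.2 he, rfl⟩), Iso.refl 0⟩
    · rcases mem_rightOptions_adjoint.1 hx with ⟨y, hy, rfl⟩ | ⟨he, rfl⟩
      · obtain ⟨z, hz, hyz⟩ := h1 y hy
        exact ⟨_, adjoint_mem_rightOptions hz, ihL y hy hyz⟩
      · exact ⟨0, mem_rightOptions_adjoint.2
          (Or.inr ⟨h.leftOptions_eq_empty_iff.1 he, rfl⟩), Iso.refl 0⟩
    · rcases mem_rightOptions_adjoint.1 hz with ⟨y, hy, rfl⟩ | ⟨he, rfl⟩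
      · obtain ⟨x, hx, hxy⟩ := h2 y hy
        exact ⟨_, adjoint_mem_rightOptions hx, ihL x hx hxy⟩
      · exact ⟨0, mem_rightOptions_adjoint.2
          (Or.inr ⟨h.leftOptions_eq_empty_iff.2 he, rfl⟩), Iso.refl 0⟩

theorem IsImpartial.adjoint {G : Game.{u}} (h : G.IsImpartial) : G.adjoint.IsImpartial := by
  induction G using options_induction with
  | _ G ihL ihR =>
    refine isImpartial_iff.2 ⟨fun x hx => ?_, fun x hx => ?_, fun x hx => ?_, fun x hx => ?_⟩
    · rcases mem_leftOptions_adjoint.1 hx with ⟨y, hy, rfl⟩ | ⟨he, rfl⟩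
      · obtain ⟨z, hz, hzy⟩ := h.exists_left hy
        exact ⟨_, adjoint_mem_rightOptions hz, hzy.adjoint.symm⟩
      · exact ⟨0, mem_rightOptions_adjoint.2
          (Or.inr ⟨h.rightOptions_eq_empty_iff.1 he, rfl⟩), Iso.refl 0⟩
    · rcases mem_rightOptions_adjoint.1 hx with ⟨y, hy, rfl⟩ | ⟨he, rfl⟩
      · obtain ⟨z, hz, hyz⟩ := h.exists_right hy
        exact ⟨_, adjoint_mem_leftOptions hz, hyz.adjoint.symm⟩
      · exact ⟨0, mem_leftOptions_adjoint.2
          (Or.inr ⟨h.rightOptions_eq_empty_iff.2 he, rfl⟩), Iso.refl 0⟩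
    · rcases mem_leftOptions_adjoint.1 hx with ⟨y, hy, rfl⟩ | ⟨he, rfl⟩
      · exact ihR y hy (h.of_right hy)
      · exact isImpartial_zero
    · rcases mem_rightOptions_adjoint.1 hx with ⟨y, hy, rfl⟩ | ⟨he, rfl⟩
      · exact ihL y hy (h.of_left hy)
      · exact isImpartial_zero

/-! ### The order on partizan games -/

/-- If `G ≱ H`, the two games can be told apart by Left moving first. -/
theorem exists_leftWins_of_not_geq {G H : Game.{u}} (h : ¬ Geq G H) :
    ∃ T : Game.{u}, ¬ (G + T).LeftWins ∧ (H + T).LeftWins := by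
  rw [geq_iff] at h
  push Not at h
  obtain ⟨X, hX⟩ := h
  by_cases h1 : (H + X).LeftWins ∧ ¬ (G + X).LeftWins
  · exact ⟨X, h1.2, h1.1⟩
  obtain ⟨hr, hr'⟩ : (G + X).RightWins ∧ ¬ (H + X).RightWins := by tauto
  -- Left's only move in the test game is to `X`; Right answers any move in `G` by the adjoint.
  refine ⟨ofSets {X} (Game.adjoint '' G.leftOptions), ?_, ?_⟩
  · have hX : X ∈ (ofSets {X} (Game.adjoint '' G.leftOptions)).leftOptions := by simp
    refine not_leftWins_iff.2 ⟨⟨_, add_mem_leftOptions_right hX G⟩, fun x hx => ?_⟩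
    rcases mem_leftOptions_add.1 hx with ⟨y, hy, rfl⟩ | ⟨z, hz, rfl⟩
    · refine rightWins_of_mem (add_mem_rightOptions_right ?_ y) (not_wins_add_adjoint y).1
      rw [rightOptions_ofSets]
      exact ⟨y, hy, rfl⟩
    · rw [leftOptions_ofSets] at hz
      rwa [Set.mem_singleton_iff.1 hz]
  · exact leftWins_of_mem (add_mem_leftOptions_right (by simp) H) hr'

/-- If `G ≱ H`, the two games can be told apart by Right moving first. -/
theorem exists_rightWins_of_not_geq {G H : Game.{u}} (h : ¬ Geq G H) :
    ∃ T : Game.{u}, (G + T).RightWins ∧ ¬ (H + T).RightWins := by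
  have h' : ¬ Geq H.neg G.neg := fun hn => h (by simpa using hn.neg)
  obtain ⟨T, h1, h2⟩ := exists_leftWins_of_not_geq h'
  rw [leftWins_neg_add] at h1 h2
  exact ⟨T.neg, h2, h1⟩

/-- If no Left option of `G` is at least `H` and no Right option of `H` is at most `G`, then some
test game makes Left lose moving first in the sum with `G` and Right lose moving first in the
sum with `H`. -/
theorem exists_downlink {G H : Game.{u}} (hG : ∀ x ∈ G.leftOptions, ¬ Geq x H)
    (hH : ∀ y ∈ H.rightOptions, ¬ Geq G y) :
    ∃ T : Game.{u}, ¬ (G + T).LeftWins ∧ ¬ (H + T).RightWins := by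
  choose X hX using fun x : G.leftOptions => exists_leftWins_of_not_geq (hG x x.2)
  choose Y hY using fun y : H.rightOptions => exists_rightWins_of_not_geq (hH y y.2)
  -- The options of the adjoints make sure that both players have moves.
  let T := ofSets (Set.range Y ∪ G.adjoint.leftOptions) (Set.range X ∪ H.adjoint.rightOptions)
  have hTL : T.leftOptions = Set.range Y ∪ G.adjoint.leftOptions := leftOptions_ofSets _ _
  have hTR : T.rightOptions = Set.range X ∪ H.adjoint.rightOptions := rightOptions_ofSets _ _
  refine ⟨T, not_leftWins_iff.2 ⟨?_, fun x hx => ?_⟩, not_rightWins_iff.2 ⟨?_, fun x hx => ?_⟩⟩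
  · obtain ⟨z, hz⟩ := leftOptions_adjoint_nonempty G
    exact ⟨_, add_mem_leftOptions_right (hTL.ge <| Or.inr hz) G⟩
  · rcases mem_leftOptions_add.1 hx with ⟨y, hy, rfl⟩ | ⟨z, hz, rfl⟩
    · exact rightWins_of_mem (add_mem_rightOptions_right (hTR.ge <| Or.inl ⟨⟨y, hy⟩, rfl⟩) y)
        (hX ⟨y, hy⟩).1
    · rw [hTL] at hz
      rcases hz with ⟨y, rfl⟩ | hz
      · exact (hY y).1
      · exact (not_leftWins_iff.1 (not_wins_add_adjoint G).1).2 _ (add_mem_leftOptions_right hz G)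
  · obtain ⟨z, hz⟩ := rightOptions_adjoint_nonempty H
    exact ⟨_, add_mem_rightOptions_right (hTR.ge <| Or.inr hz) H⟩
  · rcases mem_rightOptions_add.1 hx with ⟨y, hy, rfl⟩ | ⟨z, hz, rfl⟩
    · exact leftWins_of_mem (add_mem_leftOptions_right (hTL.ge <| Or.inl ⟨⟨y, hy⟩, rfl⟩) y)
        (hY ⟨y, hy⟩).2
    · rw [hTR] at hz
      rcases hz with ⟨x, rfl⟩ | hz
      · exact (hX x).2
      · exact (not_rightWins_iff.1 (not_wins_add_adjoint H).2).2 _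
          (add_mem_rightOptions_right hz H)

theorem Geq.exists_of_left {G H : Game.{u}} (h : Geq G H) {y : Game.{u}}
    (hy : y ∈ H.leftOptions) :
    (∃ z ∈ y.rightOptions, Geq G z) ∨ ∃ x ∈ G.leftOptions, Geq x y := by
  by_contra! hn
  obtain ⟨T, h1, h2⟩ := exists_downlink hn.2 hn.1
  exact h1 (h.leftWins (leftWins_of_mem (add_mem_leftOptions_left hy T) h2))

theorem Geq.exists_of_right {G H : Game.{u}} (h : Geq G H) {x : Game.{u}}
    (hx : x ∈ G.rightOptions) :
    (∃ z ∈ x.leftOptions, Geq z H) ∨ ∃ y ∈ H.rightOptions, Geq x y := by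
  by_contra! hn
  obtain ⟨T, h1, h2⟩ := exists_downlink hn.1 hn.2
  exact h2 (h.rightWins (rightWins_of_mem (add_mem_rightOptions_left hx T) h1))

theorem Geq.leftOptions_eq_empty {G H : Game.{u}} (h : Geq G H) (hH : H.leftOptions = ∅) :
    G.leftOptions = ∅ := by
  by_contra hG
  obtain ⟨x, hx⟩ := Set.nonempty_iff_ne_empty.2 hG
  -- Without Left options in `H`, Left wins at once; in `G` every Left move has a losing reply.
  have hT : (H + ofSets ∅ (Game.adjoint '' G.leftOptions)).LeftWins := by
    refine leftWins_iff.2 (Or.inl (Set.eq_empty_iff_forall_notMem.2 fun x hx => ?_))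
    rcases mem_leftOptions_add.1 hx with ⟨y, hy, -⟩ | ⟨y, hy, -⟩
    · simp [hH] at hy
    · simp at hy
  refine not_leftWins_iff.2 ⟨⟨_, add_mem_leftOptions_left hx _⟩, fun y hy => ?_⟩ (h.leftWins hT)
  rcases mem_leftOptions_add.1 hy with ⟨z, hz, rfl⟩ | ⟨z, hz, -⟩
  · refine rightWins_of_mem (add_mem_rightOptions_right ?_ z) (not_wins_add_adjoint z).1
    rw [rightOptions_ofSets]
    exact ⟨z, hz, rfl⟩
  · simp at hz

theorem leftOptions_neg_eq_empty_iff {G : Game.{u}} :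
    G.neg.leftOptions = ∅ ↔ G.rightOptions = ∅ := by
  simp only [Set.eq_empty_iff_forall_notMem, mem_leftOptions_neg]
  exact ⟨fun h y hy => h _ ⟨y, hy, rfl⟩, fun h x ⟨y, hy, _⟩ => h y hy⟩

theorem Geq.rightOptions_eq_empty {G H : Game.{u}} (h : Geq G H) (hG : G.rightOptions = ∅) :
    H.rightOptions = ∅ :=
  leftOptions_neg_eq_empty_iff.1 (h.neg.leftOptions_eq_empty (leftOptions_neg_eq_empty_iff.2 hG))

theorem geq_of_options {G H : Game.{u}}
    (h1 : ∀ y ∈ H.leftOptions,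
      (∃ z ∈ y.rightOptions, Geq G z) ∨ ∃ x ∈ G.leftOptions, Geq x y)
    (h2 : ∀ x ∈ G.rightOptions,
      (∃ z ∈ x.leftOptions, Geq z H) ∨ ∃ y ∈ H.rightOptions, Geq x y)
    (h3 : H.leftOptions = ∅ → G.leftOptions = ∅)
    (h4 : G.rightOptions = ∅ → H.rightOptions = ∅) : Geq G H := by
  refine geq_iff.2 fun X => ?_
  induction X using options_induction with
  | _ X ihL ihR =>
    constructor
    · intro hw
      rcases leftWins_iff.1 hw with he | ⟨w, hw, hn⟩
      · refine leftWins_iff.2 (Or.inl (Set.eq_empty_iff_forall_notMem.2 fun x hx => ?_))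
        have hH : H.leftOptions = ∅ := Set.eq_empty_iff_forall_notMem.2 fun y hy =>
          Set.eq_empty_iff_forall_notMem.1 he _ (add_mem_leftOptions_left hy X)
        rcases mem_leftOptions_add.1 hx with ⟨y, hy, -⟩ | ⟨y, hy, -⟩
        · simp [h3 hH] at hy
        · exact Set.eq_empty_iff_forall_notMem.1 he _ (add_mem_leftOptions_right hy H)
      · rcases mem_leftOptions_add.1 hw with ⟨y, hy, rfl⟩ | ⟨y, hy, rfl⟩
        · rcases h1 y hy with ⟨z, hz, hGz⟩ | ⟨x, hx, hxy⟩
          · exact hGz.leftWins ((not_rightWins_iff.1 hn).2 _ (add_mem_rightOptions_left hz X))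
          · exact leftWins_of_mem (add_mem_leftOptions_left hx X) fun hr => hn (hxy.rightWins hr)
        · exact leftWins_of_mem (add_mem_leftOptions_right hy G) fun hr => hn ((ihL y hy).2 hr)
    · intro hw
      rcases rightWins_iff.1 hw with he | ⟨w, hw, hn⟩
      · refine rightWins_iff.2 (Or.inl (Set.eq_empty_iff_forall_notMem.2 fun x hx => ?_))
        have hG : G.rightOptions = ∅ := Set.eq_empty_iff_forall_notMem.2 fun y hy =>
          Set.eq_empty_iff_forall_notMem.1 he _ (add_mem_rightOptions_left hy X)
        rcases mem_rightOptions_add.1 hx with ⟨y, hy, -⟩ | ⟨y, hy, -⟩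
        · simp [h4 hG] at hy
        · exact Set.eq_empty_iff_forall_notMem.1 he _ (add_mem_rightOptions_right hy G)
      · rcases mem_rightOptions_add.1 hw with ⟨x, hx, rfl⟩ | ⟨y, hy, rfl⟩
        · rcases h2 x hx with ⟨z, hz, hzH⟩ | ⟨y, hy, hxy⟩
          · exact hzH.rightWins ((not_leftWins_iff.1 hn).2 _ (add_mem_leftOptions_left hz X))
          · exact rightWins_of_mem (add_mem_rightOptions_left hy X) fun hl => hn (hxy.leftWins hl)
        · exact rightWins_of_mem (add_mem_rightOptions_right hy H) fun hl => hn ((ihR y hy).1 hl)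

theorem geq_iff_options {G H : Game.{u}} :
    Geq G H ↔
      (∀ y ∈ H.leftOptions,
        (∃ z ∈ y.rightOptions, Geq G z) ∨ ∃ x ∈ G.leftOptions, Geq x y) ∧
      (∀ x ∈ G.rightOptions,
        (∃ z ∈ x.leftOptions, Geq z H) ∨ ∃ y ∈ H.rightOptions, Geq x y) ∧
      (H.leftOptions = ∅ → G.leftOptions = ∅) ∧
      (G.rightOptions = ∅ → H.rightOptions = ∅) :=
  ⟨fun h => ⟨fun _ => h.exists_of_left, fun _ => h.exists_of_right, h.leftOptions_eq_empty,
    h.rightOptions_eq_empty⟩, fun ⟨h1, h2, h3, h4⟩ => geq_of_options h1 h2 h3 h4⟩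

/-! ### Partizan equivalence of impartial games -/

theorem IsImpartial.partEquiv_of_geq {G H : Game.{u}} (hG : G.IsImpartial) (hH : H.IsImpartial)
    (h : Geq G H) : PartEquiv G H :=
  ⟨h, hG.geq_symm hH h⟩

theorem IsImpartial.exists_right_of_option {G : Game.{u}} (h : G.IsImpartial) {x : Game.{u}}
    (hx : x ∈ G.options) : ∃ y ∈ G.rightOptions, Iso y x := by
  obtain ⟨z, hz, hzx⟩ := h.exists_left_of_option hx
  obtain ⟨y, hy, hzy⟩ := h.exists_right hz
  exact ⟨y, hy, hzy.symm.trans hzx⟩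

theorem Iso.exists_option {G H : Game.{u}} (h : Iso G H) {x : Game.{u}} (hx : x ∈ G.options) :
    ∃ y ∈ H.options, Iso x y := by
  obtain ⟨h1, -, h3, -⟩ := iso_iff.1 h
  rcases hx with hx | hx
  · obtain ⟨y, hy, hxy⟩ := h1 x hx; exact ⟨y, Or.inl hy, hxy⟩
  · obtain ⟨y, hy, hxy⟩ := h3 x hx; exact ⟨y, Or.inr hy, hxy⟩

theorem PartEquiv.exists_of_option {G H : Game.{u}} (hG : G.IsImpartial) (hH : H.IsImpartial)
    (h : PartEquiv G H) {y : Game.{u}} (hy : y ∈ H.options) :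
    (∃ z ∈ y.options, PartEquiv z G) ∨ ∃ x ∈ G.options, PartEquiv x y := by
  obtain ⟨y', hy', hyy⟩ := hH.exists_left_of_option hy
  have hyi := hH.of_option hy
  rcases h.1.exists_of_left hy' with ⟨z, hz, hGz⟩ | ⟨x, hx, hxy⟩
  · obtain ⟨w, hw, hzw⟩ := hyy.exists_option (right_mem_options hz)
    exact Or.inl ⟨w, hw, (hG.partEquiv_of_geq (hyi.of_option hw) (hGz.trans hzw.geq)).symm⟩
  · exact Or.inr ⟨x, Or.inl hx, (hG.of_left hx).partEquiv_of_geq hyi (hxy.trans hyy.geq)⟩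

theorem PartEquiv.iso_zero_iff {G H : Game.{u}} (hG : G.IsImpartial) (hH : H.IsImpartial)
    (h : PartEquiv G H) : Iso G 0 ↔ Iso H 0 := by
  rw [hG.iso_zero_iff, hH.iso_zero_iff]
  exact ⟨h.2.leftOptions_eq_empty, h.1.leftOptions_eq_empty⟩

theorem partEquiv_iff_options {G H : Game.{u}} (hG : G.IsImpartial) (hH : H.IsImpartial) :
    PartEquiv G H ↔
      (∀ H' ∈ H.options,
        (∃ H'' ∈ H'.options, PartEquiv H'' G) ∨ ∃ G' ∈ G.options, PartEquiv G' H') ∧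
      (∀ G' ∈ G.options,
        (∃ G'' ∈ G'.options, PartEquiv G'' H) ∨ ∃ H' ∈ H.options, PartEquiv H' G') ∧
      (Iso G 0 ↔ Iso H 0) := by
  refine ⟨fun h => ⟨fun _ => h.exists_of_option hG hH, fun _ => h.symm.exists_of_option hH hG,
    h.iso_zero_iff hG hH⟩, fun ⟨h1, h2, h3⟩ => hG.partEquiv_of_geq hH ?_⟩
  refine geq_of_options (fun y hy => ?_) (fun x hx => ?_) (fun he => ?_) (fun he => ?_)
  · rcases h1 y (Or.inl hy) with ⟨z, hz, hzG⟩ | ⟨x, hx, hxy⟩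
    · obtain ⟨w, hw, hwz⟩ := (hH.of_left hy).exists_right_of_option hz
      exact Or.inl ⟨w, hw, hzG.2.trans hwz.symm.geq⟩
    · obtain ⟨w, hw, hwx⟩ := hG.exists_left_of_option hx
      exact Or.inr ⟨w, hw, hwx.geq.trans hxy.1⟩
  · rcases h2 x (Or.inr hx) with ⟨z, hz, hzH⟩ | ⟨y, hy, hyx⟩
    · obtain ⟨w, hw, hwz⟩ := (hG.of_right hx).exists_left_of_option hz
      exact Or.inl ⟨w, hw, hwz.geq.trans hzH.1⟩
    · obtain ⟨w, hw, hwy⟩ := hH.exists_right_of_option hy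
      exact Or.inr ⟨w, hw, hyx.2.trans hwy.symm.geq⟩
  · exact hG.iso_zero_iff.1 (h3.2 (hH.iso_zero_iff.2 he))
  · rw [hH.rightOptions_eq_empty_iff]
    exact hH.iso_zero_iff.1 (h3.1 (hG.iso_zero_iff.2 (hG.rightOptions_eq_empty_iff.1 he)))

/-! ### Impartial equivalence -/

theorem exists_leftWins_of_not_impEquiv {G H : Game.{u}} (hG : G.IsImpartial)
    (hH : H.IsImpartial) (h : ¬ ImpEquiv G H) :
    ∃ T : Game.{u}, T.IsImpartial ∧ ¬ (G + T).LeftWins ∧ (H + T).LeftWins := by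
  rw [impEquiv_iff hG hH] at h
  push Not at h
  obtain ⟨X, hXi, hX⟩ := h
  by_cases h1 : (H + X).LeftWins
  · exact ⟨X, hXi, by tauto, h1⟩
  have h2 : (G + X).LeftWins := by tauto
  -- The moves to `X` and to the adjoints of the options of `G` reverse the roles of `G` and `H`.
  let s : Set Game.{u} := {X} ∪ Game.adjoint '' G.leftOptions
  have hTi : (ofSets s s).IsImpartial := by
    refine isImpartial_ofSets ?_
    rintro _ (rfl | ⟨y, hy, rfl⟩)
    · exact hXi
    · exact (hG.of_left hy).adjoint
  have hTL : (ofSets s s).leftOptions = s := leftOptions_ofSets s s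
  have hXs : X ∈ (ofSets s s).leftOptions := hTL.ge <| Or.inl rfl
  refine ⟨ofSets s s, hTi, (hG.add hTi).not_leftWins_iff.2
    ⟨⟨_, add_mem_leftOptions_right hXs G⟩, fun x hx => ?_⟩,
    (hH.add hTi).leftWins_of_mem (add_mem_leftOptions_right hXs H) h1⟩
  rcases mem_leftOptions_add.1 hx with ⟨y, hy, rfl⟩ | ⟨z, hz, rfl⟩
  · exact ((hG.of_left hy).add hTi).leftWins_of_mem
      (add_mem_leftOptions_right (hTL.ge <| Or.inr ⟨y, hy, rfl⟩) y) (not_wins_add_adjoint y).1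
  · rw [hTL] at hz
    rcases hz with rfl | ⟨y, hy, rfl⟩
    · exact h2
    · exact (hG.add (hG.of_left hy).adjoint).leftWins_of_mem (add_mem_leftOptions_left hy _)
        (not_wins_add_adjoint y).1

/-- If no option of either game is equivalent to the other game, then some impartial test game
makes the first player lose in both sums. -/
theorem exists_link {G H : Game.{u}} (hG : G.IsImpartial) (hH : H.IsImpartial)
    (h1 : ∀ x ∈ G.leftOptions, ¬ ImpEquiv x H) (h2 : ∀ y ∈ H.leftOptions, ¬ ImpEquiv y G) :
    ∃ T : Game.{u}, T.IsImpartial ∧ ¬ (G + T).LeftWins ∧ ¬ (H + T).LeftWins := by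
  choose X hXi hX using fun x : G.leftOptions =>
    exists_leftWins_of_not_impEquiv (hG.of_left x.2) hH (h1 x x.2)
  choose Y hYi hY using fun y : H.leftOptions =>
    exists_leftWins_of_not_impEquiv (hH.of_left y.2) hG (h2 y y.2)
  -- The test game must have an option even when `G` and `H` have none; then `0` serves.
  let e : Set Game.{u} := {z | z = 0 ∧ G.leftOptions = ∅ ∧ H.leftOptions = ∅}
  have : Small.{u} e :=
    small_subset (show e ⊆ {0} from fun _ hz => hz.1)
  let s : Set Game.{u} := Set.range X ∪ Set.range Y ∪ e
  have hTi : (ofSets s s).IsImpartial := by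
    refine isImpartial_ofSets ?_
    rintro _ ((⟨x, rfl⟩ | ⟨y, rfl⟩) | ⟨rfl, -, -⟩)
    · exact hXi x
    · exact hYi y
    · exact isImpartial_zero
  have hTL : (ofSets s s).leftOptions = s := leftOptions_ofSets s s
  have hne : s.Nonempty := by
    rcases G.leftOptions.eq_empty_or_nonempty with hGe | ⟨x, hx⟩
    · rcases H.leftOptions.eq_empty_or_nonempty with hHe | ⟨y, hy⟩
      · exact ⟨0, Or.inr ⟨rfl, hGe, hHe⟩⟩
      · exact ⟨_, Or.inl (Or.inr ⟨⟨y, hy⟩, rfl⟩)⟩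
    · exact ⟨_, Or.inl (Or.inl ⟨⟨x, hx⟩, rfl⟩)⟩
  obtain ⟨w, hw⟩ := hne
  rw [← hTL] at hw
  refine ⟨ofSets s s, hTi,
    (hG.add hTi).not_leftWins_iff.2 ⟨⟨_, add_mem_leftOptions_right hw G⟩, fun x hx => ?_⟩,
    (hH.add hTi).not_leftWins_iff.2 ⟨⟨_, add_mem_leftOptions_right hw H⟩, fun x hx => ?_⟩⟩
  · rcases mem_leftOptions_add.1 hx with ⟨y, hy, rfl⟩ | ⟨z, hz, rfl⟩
    · exact ((hG.of_left hy).add hTi).leftWins_of_mem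
        (add_mem_leftOptions_right (hTL.ge <| Or.inl (Or.inl ⟨⟨y, hy⟩, rfl⟩)) y) (hX ⟨y, hy⟩).1
    · rw [hTL] at hz
      rcases hz with (⟨x, rfl⟩ | ⟨y, rfl⟩) | ⟨rfl, he, -⟩
      · exact (hG.add (hXi x)).leftWins_of_mem (add_mem_leftOptions_left x.2 _) (hX x).1
      · exact (hY y).2
      · exact leftWins_add_zero he
  · rcases mem_leftOptions_add.1 hx with ⟨y, hy, rfl⟩ | ⟨z, hz, rfl⟩
    · exact ((hH.of_left hy).add hTi).leftWins_of_mem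
        (add_mem_leftOptions_right (hTL.ge <| Or.inl (Or.inr ⟨⟨y, hy⟩, rfl⟩)) y) (hY ⟨y, hy⟩).1
    · rw [hTL] at hz
      rcases hz with (⟨x, rfl⟩ | ⟨y, rfl⟩) | ⟨rfl, -, he⟩
      · exact (hX x).2
      · exact (hH.add (hYi y)).leftWins_of_mem (add_mem_leftOptions_left y.2 _) (hY y).1
      · exact leftWins_add_zero he

theorem ImpEquiv.exists_of_option {G H : Game.{u}} (hG : G.IsImpartial) (hH : H.IsImpartial)
    (h : ImpEquiv G H) {y : Game.{u}} (hy : y ∈ H.options) :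
    (∃ z ∈ y.options, ImpEquiv z G) ∨ ∃ x ∈ G.options, ImpEquiv x y := by
  by_contra! hn
  obtain ⟨y', hy', hyy⟩ := hH.exists_left_of_option hy
  obtain ⟨T, hTi, h1, h2⟩ := exists_link hG (hH.of_option hy)
    (fun x hx => hn.2 x (Or.inl hx)) (fun z hz => hn.1 z (Or.inl hz))
  refine h1 (((impEquiv_iff hG hH).1 h T hTi).2 ?_)
  exact (hH.add hTi).leftWins_of_mem (add_mem_leftOptions_left hy' T)
    fun hw => h2 ((hyy.add (Iso.refl T)).leftWins_iff.1 hw)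

theorem ImpEquiv.outcome_of_iso_zero {G H : Game.{u}} (h : ImpEquiv G H) (hG : Iso G 0) :
    H.outcome = .N := by
  rw [← (add_zero_iso H).outcome_eq, ← h 0 isImpartial_zero, (add_zero_iso G).outcome_eq,
    hG.outcome_eq, outcome_eq_N_iff, Game.leftWins_iff, Game.rightWins_iff]
  simp

theorem IsImpartial.leftWins_of_option {G x : Game.{u}} (h : G.IsImpartial) (hx : x ∈ G.options)
    (hw : ¬ x.LeftWins) : G.LeftWins := by
  obtain ⟨y, hy, hyx⟩ := h.exists_left_of_option hx
  exact h.leftWins_of_mem hy fun hl => hw (hyx.leftWins_iff.1 hl)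

theorem add_mem_options_left {G y : Game.{u}} (h : y ∈ G.options) (H : Game.{u}) :
    y + H ∈ (G + H).options :=
  h.imp (fun h => add_mem_leftOptions_left h H) (fun h => add_mem_rightOptions_left h H)

theorem impEquiv_of_options {G H : Game.{u}} (hG : G.IsImpartial) (hH : H.IsImpartial)
    (h1 : ∀ H' ∈ H.options,
      (∃ H'' ∈ H'.options, ImpEquiv H'' G) ∨ ∃ G' ∈ G.options, ImpEquiv G' H')
    (h2 : ∀ G' ∈ G.options,
      (∃ G'' ∈ G'.options, ImpEquiv G'' H) ∨ ∃ H' ∈ H.options, ImpEquiv H' G')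
    (h3 : Iso G 0 → H.LeftWins) (h4 : Iso H 0 → G.LeftWins) : ImpEquiv G H := by
  -- One direction, to be applied to both orders of the two games.
  have key : ∀ {G H : Game.{u}}, G.IsImpartial → H.IsImpartial →
      (∀ G' ∈ G.options,
        (∃ G'' ∈ G'.options, ImpEquiv G'' H) ∨ ∃ H' ∈ H.options, ImpEquiv H' G') →
      (Iso G 0 → H.LeftWins) → ∀ X : Game.{u}, X.IsImpartial →
      (∀ y ∈ X.leftOptions, (H + y).LeftWins → (G + y).LeftWins) →
      (G + X).LeftWins → (H + X).LeftWins := by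
    intro G H hG hH h2 h3 X hX ih hw
    rcases (hG.add hX).leftWins_iff.1 hw with he | ⟨w, hw, hn⟩
    · have he' := Set.eq_empty_iff_forall_notMem.1 he
      have hG0 : Iso G 0 := hG.iso_zero_iff.2 (Set.eq_empty_iff_forall_notMem.2 fun y hy =>
        he' _ (add_mem_leftOptions_left hy X))
      have hX0 : Iso X 0 := hX.iso_zero_iff.2 (Set.eq_empty_iff_forall_notMem.2 fun y hy =>
        he' _ (add_mem_leftOptions_right hy G))
      exact (((Iso.refl H).add hX0).trans (add_zero_iso H)).leftWins_iff.2 (h3 hG0)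
    · rcases mem_leftOptions_add.1 hw with ⟨x, hx, rfl⟩ | ⟨y, hy, rfl⟩
      · rcases h2 x (Or.inl hx) with ⟨z, hz, hzH⟩ | ⟨y, hy, hyx⟩
        · have hxi := hG.of_left hx
          refine ((impEquiv_iff (hxi.of_option hz) hH).1 hzH X hX).1 ?_
          by_contra hc
          exact hn ((hxi.add hX).leftWins_of_option (add_mem_options_left hz X) hc)
        · refine (hH.add hX).leftWins_of_option (add_mem_options_left hy X) fun hl => hn ?_
          exact ((impEquiv_iff (hH.of_option hy) (hG.of_left hx)).1 hyx X hX).1 hl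
      · exact (hH.add hX).leftWins_of_mem (add_mem_leftOptions_right hy H)
          fun hl => hn (ih y hy hl)
  refine (impEquiv_iff hG hH).2 fun X hX => ?_
  induction X using options_induction with
  | _ X ihL ihR =>
    exact ⟨key hG hH h2 h3 X hX fun y hy => (ihL y hy (hX.of_left hy)).2,
      key hH hG h1 h4 X hX fun y hy => (ihL y hy (hX.of_left hy)).1⟩

theorem impEquiv_iff_options {G H : Game.{u}} (hG : G.IsImpartial) (hH : H.IsImpartial) :
    ImpEquiv G H ↔
      (∀ H' ∈ H.options,
        (∃ H'' ∈ H'.options, ImpEquiv H'' G) ∨ ∃ G' ∈ G.options, ImpEquiv G' H') ∧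
      (∀ G' ∈ G.options,
        (∃ G'' ∈ G'.options, ImpEquiv G'' H) ∨ ∃ H' ∈ H.options, ImpEquiv H' G') ∧
      (Iso G 0 → H.outcome = .N) ∧ (Iso H 0 → G.outcome = .N) :=
  ⟨fun h => ⟨fun _ => h.exists_of_option hG hH, fun _ => h.symm.exists_of_option hH hG,
    h.outcome_of_iso_zero, h.symm.outcome_of_iso_zero⟩, fun ⟨h1, h2, h3, h4⟩ =>
    impEquiv_of_options hG hH h1 h2 (fun h => hH.outcome_eq_N_iff.1 (h3 h))
      (fun h => hG.outcome_eq_N_iff.1 (h4 h))⟩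

end Game

open Game

/-! ### Parity of ordinals -/

theorem two_mul_div_two (m : Ordinal.{u}) : 2 * m / 2 = m :=
  Ordinal.mul_div_cancel m two_ne_zero

theorem two_mul_add_one_div_two (m : Ordinal.{u}) : (2 * m + 1) / 2 = m := by
  rw [Ordinal.mul_add_div m two_ne_zero, Ordinal.div_eq_zero_of_lt one_lt_two, add_zero]

theorem not_oddSize_two_mul (m : Ordinal.{u}) : ¬ OddSize (2 * m) := by
  simp [OddSize, Ordinal.mul_mod]

theorem oddSize_two_mul_add_one (m : Ordinal.{u}) : OddSize (2 * m + 1) := by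
  rw [OddSize, Ordinal.mul_add_mod_self, Ordinal.mod_eq_of_lt one_lt_two]

theorem eq_of_oddSize {a : Ordinal.{u}} (h : OddSize a) : a = 2 * (a / 2) + 1 := by
  conv_lhs => rw [← Ordinal.div_add_mod a 2, h]

theorem eq_of_not_oddSize {a : Ordinal.{u}} (h : ¬ OddSize a) : a = 2 * (a / 2) := by
  have h2 : a % 2 < 2 := Ordinal.mod_lt a two_ne_zero
  have h0 : a % 2 = 0 := by
    refine Order.lt_one_iff.1 (lt_of_le_of_ne (Order.lt_add_one_iff.1 ?_) h)
    rwa [one_add_one_eq_two]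
  conv_lhs => rw [← Ordinal.div_add_mod a 2, h0, add_zero]

theorem eq_two_mul_or (a : Ordinal.{u}) : (∃ m, a = 2 * m) ∨ ∃ m, a = 2 * m + 1 := by
  by_cases h : OddSize a
  · exact Or.inr ⟨_, eq_of_oddSize h⟩
  · exact Or.inl ⟨_, eq_of_not_oddSize h⟩

theorem pred_of_oddSize {a : Ordinal.{u}} (h : OddSize a) : a.pred = 2 * (a / 2) := by
  conv_lhs => rw [eq_of_oddSize h, Ordinal.pred_add_one]

theorem two_mul_lt_two_mul {m n : Ordinal.{u}} (h : m < n) : 2 * m < 2 * n :=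
  mul_lt_mul_of_pos_left h two_pos

theorem two_mul_add_one_lt_two_mul {m n : Ordinal.{u}} (h : m < n) : 2 * m + 1 < 2 * n := by
  have h1 : 2 * (m + 1) ≤ 2 * n := by gcongr; exact Order.add_one_le_of_lt h
  refine lt_of_lt_of_le ?_ h1
  rw [mul_add, mul_one]
  gcongr
  exact one_lt_two

theorem div_two_lt {a m : Ordinal.{u}} (h : a < 2 * m) : a / 2 < m :=
  (Ordinal.lt_mul_iff_div_lt two_ne_zero).1 h

theorem xorOne_two_mul (m : Ordinal.{u}) : xorOne (2 * m) = 2 * m + 1 :=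
  if_neg (not_oddSize_two_mul m)

theorem xorOne_two_mul_add_one (m : Ordinal.{u}) : xorOne (2 * m + 1) = 2 * m := by
  rw [xorOne, if_pos (oddSize_two_mul_add_one m), Ordinal.pred_add_one]

theorem xorOne_xorOne (a : Ordinal.{u}) : xorOne (xorOne a) = a := by
  rcases eq_two_mul_or a with ⟨m, rfl⟩ | ⟨m, rfl⟩
  · rw [xorOne_two_mul, xorOne_two_mul_add_one]
  · rw [xorOne_two_mul_add_one, xorOne_two_mul]

theorem xorOne_lt_two_mul {a m : Ordinal.{u}} (h : a < 2 * m) : xorOne a < 2 * m := by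
  have h' := div_two_lt h
  rcases eq_two_mul_or a with ⟨k, rfl⟩ | ⟨k, rfl⟩
  · rw [two_mul_div_two] at h'
    rw [xorOne_two_mul]
    exact two_mul_add_one_lt_two_mul h'
  · rw [two_mul_add_one_div_two] at h'
    rw [xorOne_two_mul_add_one]
    exact two_mul_lt_two_mul h'

/-! ### Heaps -/

theorem leftOptions_heap (a : Ordinal.{u}) : (heap a).leftOptions = heap '' Set.Iio a := by
  rw [heap]
  ext x
  constructor
  · rintro ⟨i, rfl⟩
    exact ⟨_, (Ordinal.ToType.toOrd i).2, rfl⟩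
  · rintro ⟨b, hb, rfl⟩
    exact ⟨Ordinal.ToType.mk ⟨b, hb⟩, by simp⟩

theorem rightOptions_heap (a : Ordinal.{u}) : (heap a).rightOptions = heap '' Set.Iio a := by
  rw [← leftOptions_heap, heap]
  rfl

theorem mem_options_heap {a : Ordinal.{u}} {x : Game.{u}} :
    x ∈ (heap a).options ↔ ∃ b < a, x = heap b := by
  rw [options, leftOptions_heap, rightOptions_heap, Set.union_self]
  simp [eq_comm]

theorem mem_options_add {G H x : Game.{u}} :
    x ∈ (G + H).options ↔ (∃ y ∈ G.options, x = y + H) ∨ ∃ y ∈ H.options, x = G + y := by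
  simp only [options, Set.mem_union, mem_leftOptions_add, mem_rightOptions_add]
  simp only [or_and_right, exists_or]
  exact or_or_or_comm

theorem add_mem_options_right {H y : Game.{u}} (h : y ∈ H.options) (G : Game.{u}) :
    G + y ∈ (G + H).options :=
  mem_options_add.2 (Or.inr ⟨y, h, rfl⟩)

theorem not_iso_zero_of_option {G x : Game.{u}} (hx : x ∈ G.options) : ¬ Iso G 0 := fun h => by
  obtain ⟨h1, h2⟩ := iso_zero_iff.1 h
  simp [options, h1, h2] at hx

theorem heap_zero_iso : Iso (heap (0 : Ordinal.{u})) 0 := by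
  rw [iso_zero_iff, leftOptions_heap, rightOptions_heap]
  simp

theorem isImpartial_heap (a : Ordinal.{u}) : (heap a).IsImpartial := by
  induction a using WellFoundedLT.induction with
  | _ a ih =>
    have hb : ∀ x ∈ heap '' Set.Iio a, x.IsImpartial := by
      rintro _ ⟨b, hb, rfl⟩; exact ih b hb
    rw [isImpartial_iff, leftOptions_heap, rightOptions_heap]
    exact ⟨fun x hx => ⟨x, hx, Iso.refl x⟩, fun x hx => ⟨x, hx, Iso.refl x⟩, hb, hb⟩

theorem leftWins_heap_zero : (heap (0 : Ordinal.{u})).LeftWins :=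
  leftWins_iff.2 (Or.inl (iso_zero_iff.1 heap_zero_iso).1)

theorem not_leftWins_heap_one : ¬ (heap (1 : Ordinal.{u})).LeftWins := by
  rw [(isImpartial_heap 1).not_leftWins_iff, leftOptions_heap]
  refine ⟨⟨_, 0, Set.mem_Iio.2 one_pos, rfl⟩, ?_⟩
  rintro _ ⟨b, hb, rfl⟩
  rw [Order.lt_one_iff.1 (Set.mem_Iio.1 hb)]
  exact leftWins_heap_zero

theorem add_heap_zero_iso (G : Game.{u}) : Iso (G + heap 0) G :=
  ((Iso.refl G).add heap_zero_iso).trans (add_zero_iso G)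

/-- Adding a heap of size one to a heap of size `n` gives a game equivalent to the heap of size
`n ⊕ 1`. -/
theorem heap_add_one_impEquiv (n : Ordinal.{u}) :
    ImpEquiv (heap n + heap 1) (heap (xorOne n)) := by
  induction n using WellFoundedLT.induction with
  | _ n ih =>
    have h1 : (heap (1 : Ordinal.{u})).IsImpartial := isImpartial_heap 1
    have hdel : heap n + heap 0 ∈ (heap n + heap 1).options :=
      add_mem_options_right (mem_options_heap.2 ⟨0, one_pos, rfl⟩) _
    have hlow : ∀ {b c : Ordinal.{u}}, b < c → heap b + heap 1 ∈ (heap c + heap 1).options :=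
      fun hb => add_mem_options_left (mem_options_heap.2 ⟨_, hb, rfl⟩) _
    have ih' : ∀ b, xorOne b < n → ImpEquiv (heap (xorOne b) + heap 1) (heap b) := fun b hb => by
      simpa only [xorOne_xorOne] using ih _ hb
    rcases eq_two_mul_or n with ⟨m, rfl⟩ | ⟨m, rfl⟩
    · rw [xorOne_two_mul]
      refine impEquiv_of_options ((isImpartial_heap _).add h1) (isImpartial_heap _) ?_ ?_
        (fun h => absurd h (not_iso_zero_of_option hdel))
        (fun h => absurd h (not_iso_zero_of_option
          (mem_options_heap.2 ⟨2 * m, lt_add_one _, rfl⟩)))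
      · intro H' hH'
        obtain ⟨c, hc, rfl⟩ := mem_options_heap.1 hH'
        refine Or.inr ?_
        rcases (Order.lt_add_one_iff.1 hc).eq_or_lt with rfl | hc
        · exact ⟨_, hdel, (add_heap_zero_iso _).impEquiv⟩
        · exact ⟨_, hlow (xorOne_lt_two_mul hc), ih' c (xorOne_lt_two_mul hc)⟩
      · intro G' hG'
        refine Or.inr ?_
        rcases mem_options_add.1 hG' with ⟨y, hy, rfl⟩ | ⟨y, hy, rfl⟩
        · obtain ⟨b, hb, rfl⟩ := mem_options_heap.1 hy
          exact ⟨_, mem_options_heap.2 ⟨_, (xorOne_lt_two_mul hb).trans (lt_add_one _), rfl⟩,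
            (ih b hb).symm⟩
        · obtain ⟨b, hb, rfl⟩ := mem_options_heap.1 hy
          rw [Order.lt_one_iff.1 hb]
          exact ⟨_, mem_options_heap.2 ⟨_, lt_add_one _, rfl⟩,
            (add_heap_zero_iso _).symm.impEquiv⟩
    · rw [xorOne_two_mul_add_one]
      refine impEquiv_of_options ((isImpartial_heap _).add h1) (isImpartial_heap _) ?_ ?_
        (fun h => absurd h (not_iso_zero_of_option hdel)) (fun h => ?_)
      · intro H' hH'
        obtain ⟨c, hc, rfl⟩ := mem_options_heap.1 hH'
        have hc' := (xorOne_lt_two_mul hc).trans (lt_add_one (2 * m))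
        exact Or.inr ⟨_, hlow hc', ih' c hc'⟩
      · intro G' hG'
        rcases mem_options_add.1 hG' with ⟨y, hy, rfl⟩ | ⟨y, hy, rfl⟩
        · obtain ⟨b, hb, rfl⟩ := mem_options_heap.1 hy
          rcases (Order.lt_add_one_iff.1 hb).eq_or_lt with rfl | hb'
          · exact Or.inl ⟨_, add_mem_options_right (mem_options_heap.2 ⟨0, one_pos, rfl⟩) _,
              (add_heap_zero_iso _).impEquiv⟩
          · exact Or.inr ⟨_, mem_options_heap.2 ⟨_, xorOne_lt_two_mul hb', rfl⟩, (ih b hb).symm⟩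
        · obtain ⟨b, hb, rfl⟩ := mem_options_heap.1 hy
          rw [Order.lt_one_iff.1 hb]
          exact Or.inl ⟨_, add_mem_options_left
            (mem_options_heap.2 ⟨_, lt_add_one _, rfl⟩) _, (add_heap_zero_iso _).impEquiv⟩
      · have hm : 2 * m = 0 := by
          by_contra hne
          exact not_iso_zero_of_option (mem_options_heap.2 ⟨0, pos_iff_ne_zero.2 hne, rfl⟩) h
        refine ((isImpartial_heap _).add h1).leftWins_of_option hdel fun hw => ?_
        rw [hm, zero_add] at hw
        exact not_leftWins_heap_one ((add_heap_zero_iso _).leftWins_iff.1 hw)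

/-! ### Nim positions -/

theorem nim_cons (a : Ordinal.{u}) (A : List Ordinal.{u}) : nim (a :: A) = heap a + nim A := rfl

theorem isImpartial_nim (A : List Ordinal.{u}) : (nim A).IsImpartial := by
  induction A with
  | nil => exact isImpartial_zero
  | cons a A ih => exact (isImpartial_heap a).add ih

theorem nim_singleton_iso (a : Ordinal.{u}) : Iso (nim [a]) (heap a) :=
  add_zero_iso _

theorem nim_iso_of_perm {A B : List Ordinal.{u}} (h : A.Perm B) : Iso (nim A) (nim B) := by
  induction h with
  | nil => exact Iso.refl _
  | cons a _ ih => exact (Iso.refl _).add ih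
  | swap a b l =>
    exact (add_assoc_iso _ _ _).symm.trans
      (((add_comm_iso _ _).add (Iso.refl _)).trans (add_assoc_iso _ _ _))
  | trans _ _ ih1 ih2 => exact ih1.trans ih2

theorem nim_filter_iso (A : List Ordinal.{u}) : Iso (nim (A.filter (fun a => a ≠ 0))) (nim A) := by
  induction A with
  | nil => exact Iso.refl _
  | cons a A ih =>
    by_cases ha : a = 0
    · subst ha
      simp only [ne_eq, not_true_eq_false, decide_false, Bool.false_eq_true, not_false_eq_true,
        List.filter_cons_of_neg]
      exact ih.trans ((heap_zero_iso.add (Iso.refl _)).trans (zero_add_iso _)).symm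
    · rw [List.filter_cons_of_pos (by simpa using ha)]
      exact (Iso.refl _).add ih

/-- The nonzero heaps of a Nim position. -/
noncomputable def nonzero (M : Multiset Ordinal.{u}) : Multiset Ordinal.{u} :=
  M.filter (fun a => a ≠ 0)

theorem nim_iso_of_nonzero_eq {A B : List Ordinal.{u}}
    (h : nonzero (A : Multiset Ordinal.{u}) = nonzero (B : Multiset Ordinal.{u})) :
    Iso (nim A) (nim B) := by
  rw [nonzero, nonzero, Multiset.filter_coe, Multiset.filter_coe, Multiset.coe_eq_coe] at h
  exact (nim_filter_iso A).symm.trans ((nim_iso_of_perm h).trans (nim_filter_iso B))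

/-- A move of Nim, on multisets of heap sizes: `Step M N` says that `N` arises from `M` by
lowering one heap. -/
def Step (M N : Multiset Ordinal.{u}) : Prop :=
  ∃ a b C, b < a ∧ M = a ::ₘ C ∧ N = b ::ₘ C

theorem exists_step_of_mem_options {A : List Ordinal.{u}} {x : Game.{u}}
    (hx : x ∈ (nim A).options) : ∃ B : List Ordinal.{u}, x = nim B ∧ Step A B := by
  induction A generalizing x with
  | nil => simp [nim, options] at hx
  | cons a A ih =>
    rw [nim_cons] at hx
    rcases mem_options_add.1 hx with ⟨y, hy, rfl⟩ | ⟨y, hy, rfl⟩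
    · obtain ⟨b, hb, rfl⟩ := mem_options_heap.1 hy
      exact ⟨b :: A, rfl, a, b, A, hb, rfl, rfl⟩
    · obtain ⟨B, rfl, c, d, C, hd, h1, h2⟩ := ih hy
      refine ⟨a :: B, rfl, c, d, a ::ₘ C, hd, ?_, ?_⟩
      · rw [← Multiset.cons_coe, h1, Multiset.cons_swap]
      · rw [← Multiset.cons_coe, h2, Multiset.cons_swap]

theorem mem_options_nim_append {a b : Ordinal.{u}} (h : b < a) (l m : List Ordinal.{u}) :
    nim (l ++ b :: m) ∈ (nim (l ++ a :: m)).options := by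
  induction l with
  | nil => exact add_mem_options_left (mem_options_heap.2 ⟨b, h, rfl⟩) _
  | cons c l ih => exact add_mem_options_right ih _

theorem exists_option_of_step {A : List Ordinal.{u}} {N : Multiset Ordinal.{u}}
    (h : Step A N) : ∃ B : List Ordinal.{u}, (B : Multiset Ordinal.{u}) = N ∧
      nim B ∈ (nim A).options := by
  obtain ⟨a, b, C, hb, h1, rfl⟩ := h
  have ha : a ∈ A := by
    rw [← Multiset.mem_coe, h1]; exact Multiset.mem_cons_self a C
  obtain ⟨l, m, rfl⟩ := List.append_of_mem ha
  refine ⟨l ++ b :: m, ?_, mem_options_nim_append hb l m⟩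
  have hperm : ∀ c, ((l ++ c :: m : List Ordinal.{u}) : Multiset Ordinal.{u}) =
      c ::ₘ ((l ++ m : List Ordinal.{u}) : Multiset Ordinal.{u}) := fun c => by
    rw [Multiset.cons_coe, Multiset.coe_eq_coe]; exact List.perm_middle
  rw [hperm] at h1 ⊢
  rw [(Multiset.cons_inj_right a).1 h1]

theorem nim_iso_zero_iff {A : List Ordinal.{u}} :
    Iso (nim A) 0 ↔ nonzero (A : Multiset Ordinal.{u}) = 0 := by
  constructor
  · intro h
    rw [nonzero, Multiset.filter_eq_nil]
    intro a ha h0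
    obtain ⟨C, hC⟩ := Multiset.exists_cons_of_mem ha
    obtain ⟨B, -, hB⟩ := exists_option_of_step ⟨a, 0, C, pos_iff_ne_zero.2 h0, hC, rfl⟩
    exact not_iso_zero_of_option hB h
  · intro h
    exact nim_iso_of_nonzero_eq (B := []) (by simpa [nonzero] using h)

/-! ### Moves of Nim on multisets -/

open Multiset in
theorem nonzero_eq_iff {M N : Multiset Ordinal.{u}} :
    nonzero M = nonzero N ↔ ∀ x ≠ 0, count x M = count x N := by
  rw [Multiset.ext]
  simp only [nonzero, count_filter]
  refine forall_congr' fun x => ?_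
  by_cases hx : x = 0 <;> simp [hx]

theorem nonzero_cons_of_ne {a : Ordinal.{u}} (h : a ≠ 0) (C : Multiset Ordinal.{u}) :
    nonzero (a ::ₘ C) = a ::ₘ nonzero C :=
  Multiset.filter_cons_of_pos _ h

@[simp]
theorem nonzero_zero_cons (C : Multiset Ordinal.{u}) : nonzero (0 ::ₘ C) = nonzero C :=
  Multiset.filter_cons_of_neg _ (by simp)

theorem ne_zero_of_mem_nonzero {a : Ordinal.{u}} {M : Multiset Ordinal.{u}}
    (h : a ∈ nonzero M) : a ≠ 0 :=
  (Multiset.mem_filter.1 h).2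

theorem card_nonzero_cons_le (a : Ordinal.{u}) (C : Multiset Ordinal.{u}) :
    (nonzero C).card ≤ (nonzero (a ::ₘ C)).card := by
  by_cases h : a = 0
  · subst h; simp
  · simp [nonzero_cons_of_ne h]

theorem Step.nonzero_ne_zero {M N : Multiset Ordinal.{u}} (h : Step M N) : nonzero M ≠ 0 := by
  obtain ⟨a, b, C, hb, rfl, rfl⟩ := h
  rw [nonzero_cons_of_ne (ne_bot_of_gt hb)]
  exact Multiset.cons_ne_zero

theorem Step.congr {M M' N : Multiset Ordinal.{u}} (h : Step M M')
    (hN : nonzero M = nonzero N) : ∃ N', Step N N' ∧ nonzero M' = nonzero N' := by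
  obtain ⟨a, b, C, hb, rfl, rfl⟩ := h
  have ha : a ≠ 0 := ne_bot_of_gt hb
  have haN : a ∈ N := by
    have : a ∈ nonzero N := by rw [← hN, nonzero_cons_of_ne ha]; exact Multiset.mem_cons_self a _
    exact (Multiset.mem_filter.1 this).1
  obtain ⟨D, rfl⟩ := Multiset.exists_cons_of_mem haN
  rw [nonzero_cons_of_ne ha, nonzero_cons_of_ne ha, Multiset.cons_inj_right] at hN
  refine ⟨b ::ₘ D, ⟨a, b, D, hb, rfl, rfl⟩, ?_⟩
  simp only [nonzero, Multiset.filter_cons]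
  exact congrArg _ hN

theorem Step.isDershowitzMannaLT {M N : Multiset Ordinal.{u}} (h : Step M N) :
    Multiset.IsDershowitzMannaLT (nonzero N) (nonzero M) := by
  obtain ⟨a, b, C, hb, rfl, rfl⟩ := h
  refine ⟨nonzero C, nonzero {b}, {a}, by simp, ?_, ?_, ?_⟩
  · rw [← Multiset.singleton_add, add_comm, nonzero, Multiset.filter_add]
    rfl
  · rw [nonzero_cons_of_ne (ne_bot_of_gt hb), ← Multiset.singleton_add, add_comm]
  · intro y hy
    have := (Multiset.mem_filter.1 hy).1
    rw [Multiset.mem_singleton] at this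
    exact ⟨a, by simp, this ▸ hb⟩

@[elab_as_elim]
theorem isDershowitzMannaLT_induction {P : Multiset Ordinal.{u} → Prop} (S : Multiset Ordinal.{u})
    (h : ∀ S, (∀ S', S'.IsDershowitzMannaLT S → P S') → P S) : P S :=
  Multiset.wellFounded_isDershowitzMannaLT.induction S h

theorem isDershowitzMannaLT_irrefl (M : Multiset Ordinal.{u}) :
    ¬ Multiset.IsDershowitzMannaLT M M :=
  Multiset.wellFounded_isDershowitzMannaLT.irrefl.irrefl M

theorem _root_.Multiset.IsDershowitzMannaLT.add_right {M N : Multiset Ordinal.{u}}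
    (h : M.IsDershowitzMannaLT N) (K : Multiset Ordinal.{u}) :
    (M + K).IsDershowitzMannaLT (N + K) := by
  obtain ⟨X, Y, Z, hZ, rfl, rfl, hlt⟩ := h
  exact ⟨X + K, Y, Z, hZ, by abel, by abel, hlt⟩

theorem _root_.Multiset.IsDershowitzMannaLT.add {M N M' N' : Multiset Ordinal.{u}}
    (h : M.IsDershowitzMannaLT N) (h' : M'.IsDershowitzMannaLT N') :
    (M + M').IsDershowitzMannaLT (N + N') := by
  refine (h.add_right M').trans ?_
  rw [add_comm N, add_comm N]
  exact h'.add_right N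

/-! ### Recovering a Nim position from its options -/

/-- `OptionsSubset M N`: up to empty heaps, every option of the Nim position `M` is an option
of `N`. -/
def OptionsSubset (M N : Multiset Ordinal.{u}) : Prop :=
  ∀ M', Step M M' → ∃ N', Step N N' ∧ nonzero M' = nonzero N'

/-- The largest heap size at which two positions differ cannot be more frequent in a position all
of whose options are options of the other one. -/
theorem OptionsSubset.not_count_lt {A B : Multiset Ordinal.{u}} (h : OptionsSubset A B)
    {c : Ordinal.{u}} (hc : c ≠ 0) (hlt : B.count c < A.count c)
    (heq : ∀ x, c < x → A.count x = B.count x) : False := by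
  obtain ⟨C, rfl⟩ := Multiset.exists_cons_of_mem
    (Multiset.count_pos.1 ((Nat.zero_le _).trans_lt hlt))
  -- A move of a heap `c` in `A` can only be matched by the move of a smaller heap in `B`.
  have key : ∀ a' < c, ∃ e e' D, e' < e ∧ e < c ∧ B = e ::ₘ D ∧
      ∀ x ≠ 0, (a' ::ₘ C).count x = (e' ::ₘ D).count x := by
    intro a' ha'
    obtain ⟨_, ⟨e, e', D, he, rfl, rfl⟩, hN⟩ := h _ ⟨c, a', C, ha', rfl, rfl⟩
    rw [nonzero_eq_iff] at hN
    refine ⟨e, e', D, he, ?_, rfl, hN⟩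
    have he0 : e ≠ 0 := ne_bot_of_gt he
    by_contra! hce
    have h1 := hN e he0
    rcases hce.eq_or_lt with rfl | hce
    · simp only [Multiset.count_cons_self, Multiset.count_cons_of_ne ha'.ne',
        Multiset.count_cons_of_ne he.ne'] at h1 hlt
      omega
    · have h2 := heq e hce
      simp only [Multiset.count_cons_self, Multiset.count_cons_of_ne he.ne',
        Multiset.count_cons_of_ne hce.ne', Multiset.count_cons_of_ne (ha'.trans hce).ne'] at h1 h2
      omega
  obtain ⟨b, b', D, hb, hbc, hBD, h1⟩ := key 0 (pos_iff_ne_zero.2 hc)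
  -- The answer to lowering `c` to `0` lowers a heap `b`; now lower `c` to `b` instead.
  obtain ⟨e, e', D', he, -, hBD', h2⟩ := key b hbc
  have he0 : e ≠ 0 := ne_bot_of_gt he
  have h3 := h1 e he0
  have h4 := h2 e he0
  have h5 := congrArg (Multiset.count e) (hBD.symm.trans hBD')
  simp only [Multiset.count_cons, if_neg he0, if_neg he.ne', if_true] at h3 h4 h5
  omega

theorem nonzero_eq_of_optionsSubset {A B : Multiset Ordinal.{u}} (h : OptionsSubset A B)
    (h' : OptionsSubset B A) : nonzero A = nonzero B := by
  rw [nonzero_eq_iff]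
  by_contra! hne
  obtain ⟨x, hx0, hx⟩ := hne
  let s : Finset Ordinal.{u} :=
    (A + B).toFinset.filter fun x => x ≠ 0 ∧ A.count x ≠ B.count x
  have hs : ∀ x, x ∈ s ↔ x ≠ 0 ∧ A.count x ≠ B.count x := fun x => by
    simp only [s, Finset.mem_filter, Multiset.mem_toFinset, and_iff_right_iff_imp]
    rintro ⟨-, hx⟩
    rw [← Multiset.count_pos, Multiset.count_add]
    omega
  obtain ⟨c, hc, hmax⟩ := s.exists_max_image id ⟨x, (hs x).2 ⟨hx0, hx⟩⟩
  obtain ⟨hc0, hc⟩ := (hs c).1 hc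
  have heq : ∀ x, c < x → A.count x = B.count x := fun x hcx => by
    by_contra hxne
    exact absurd (hmax x ((hs x).2 ⟨ne_bot_of_gt hcx, hxne⟩)) (not_le_of_gt hcx)
  rcases lt_or_gt_of_ne hc with hlt | hlt
  · exact h'.not_count_lt hc0 hlt fun x hx => (heq x hx).symm
  · exact h.not_count_lt hc0 hlt heq

/-- A nonzero position that is reached from `B` in two moves and all of whose options are options
of `B` is itself an option of `B`. -/
theorem OptionsSubset.exists_step {A B B' B'' : Multiset Ordinal.{u}} (h : OptionsSubset A B)
    (hA : nonzero A ≠ 0) (h1 : Step B B') (h2 : Step B' B'') (hAB : nonzero A = nonzero B'') :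
    ∃ N, Step B N ∧ nonzero A = nonzero N := by
  obtain ⟨b₁, c₁, C, hcb₁, rfl, rfl⟩ := h1
  obtain ⟨b₂, c₂, D, hcb₂, hD, rfl⟩ := h2
  rcases Multiset.cons_eq_cons.1 hD with ⟨rfl, rfl⟩ | ⟨-, K, rfl, rfl⟩
  · exact ⟨_, ⟨b₁, c₂, C, hcb₂.trans hcb₁, rfl, rfl⟩, hAB⟩
  have hb₁ : b₁ ≠ 0 := ne_bot_of_gt hcb₁
  have hb₂ : b₂ ≠ 0 := ne_bot_of_gt hcb₂
  replace h : OptionsSubset (c₂ ::ₘ c₁ ::ₘ K) (b₁ ::ₘ b₂ ::ₘ K) := fun M' hM' => by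
    obtain ⟨N, hN, hMN⟩ := hM'.congr hAB.symm
    obtain ⟨N', hN', hNN⟩ := h N hN
    exact ⟨N', hN', hMN.trans hNN⟩
  rw [hAB] at hA
  exfalso
  -- Removing a heap `a` must be matched by removing a heap, which leaves as many heaps.
  have key : ∀ a L, a ≠ 0 → c₂ ::ₘ c₁ ::ₘ K = a ::ₘ L →
      (nonzero (b₂ ::ₘ K)).card ≤ (nonzero L).card ∧
      ((nonzero (b₂ ::ₘ K)).card = (nonzero L).card →
        ∃ x L', b₁ ::ₘ b₂ ::ₘ K = x ::ₘ L' ∧ nonzero L = nonzero L') := by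
    intro a L ha hL
    obtain ⟨_, ⟨x, y, L', hyx, hL', rfl⟩, hN⟩ := h _ ⟨a, 0, L, pos_iff_ne_zero.2 ha, hL, rfl⟩
    have hx0 : x ≠ 0 := ne_bot_of_gt hyx
    rw [nonzero_zero_cons] at hN
    have h1 := congrArg (fun M => (nonzero M).card) hL'
    simp only [nonzero_cons_of_ne hb₁, nonzero_cons_of_ne hx0, Multiset.card_cons,
      add_left_inj] at h1
    rw [h1, hN]
    refine ⟨card_nonzero_cons_le y L', fun hcard => ⟨x, L', hL', ?_⟩⟩
    by_cases hy : y = 0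
    · rw [hy, nonzero_zero_cons]
    · simp [nonzero_cons_of_ne hy] at hcard
  rw [nonzero_cons_of_ne hb₂, Multiset.card_cons] at key
  -- Hence both `c₁` and `c₂` are nonzero.
  have hc : c₁ ≠ 0 ∧ c₂ ≠ 0 := by
    obtain ⟨a, ha⟩ := Multiset.exists_mem_of_ne_zero hA
    have ha0 := ne_zero_of_mem_nonzero ha
    obtain ⟨L, hL⟩ := Multiset.exists_cons_of_mem (Multiset.mem_filter.1 ha).1
    have h1 := (key a L ha0 hL).1
    have h2 := congrArg (fun M => (nonzero M).card) hL
    simp only [nonzero_cons_of_ne ha0, Multiset.card_cons] at h2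
    constructor
    · rintro rfl
      have h3 : (nonzero (c₂ ::ₘ (0 : Ordinal.{u}) ::ₘ K)).card ≤ (nonzero K).card + 1 := by
        by_cases h : c₂ = 0
        · simp [h]
        · simp [nonzero_cons_of_ne h]
      omega
    · rintro rfl
      have h3 : (nonzero ((0 : Ordinal.{u}) ::ₘ c₁ ::ₘ K)).card ≤ (nonzero K).card + 1 := by
        by_cases h : c₁ = 0
        · simp [h]
        · simp [nonzero_cons_of_ne h]
      omega
  -- Comparing multiplicities, removing `c₁` shows `c₂ = b₁`, removing `c₂` shows `c₁ = b₂`.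
  have hc₁ : c₁ = b₁ ∨ c₁ = b₂ := by
    obtain ⟨x, L', hL', hLL⟩ := (key c₂ (c₁ ::ₘ K) hc.2 rfl).2 (by simp [nonzero_cons_of_ne hc.1])
    have h1 := nonzero_eq_iff.1 hLL c₁ hc.1
    have h2 := congrArg (Multiset.count c₁) hL'
    simp only [Multiset.count_cons, if_true] at h1 h2
    by_contra! hne
    rw [if_neg hne.1, if_neg hne.2] at h2
    omega
  have hc₂ : c₂ = b₁ ∨ c₂ = b₂ := by
    obtain ⟨x, L', hL', hLL⟩ := (key c₁ (c₂ ::ₘ K) hc.1 (Multiset.cons_swap _ _ _)).2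
      (by simp [nonzero_cons_of_ne hc.2])
    have h1 := nonzero_eq_iff.1 hLL c₂ hc.2
    have h2 := congrArg (Multiset.count c₂) hL'
    simp only [Multiset.count_cons, if_true] at h1 h2
    by_contra! hne
    rw [if_neg hne.1, if_neg hne.2] at h2
    omega
  have e₁ : c₁ = b₂ := hc₁.resolve_left hcb₁.ne
  have e₂ : c₂ = b₁ := hc₂.resolve_right hcb₂.ne
  exact lt_asymm (e₁ ▸ hcb₁) (e₂ ▸ hcb₂)

/-! ### Partizan equivalence of Nim positions -/

/-- The recursive test of an equivalence, as a condition on a relation between multisets of heap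
sizes: every option of the second position is reversible or matched. -/
def ReversibleOrMatched (R : Multiset Ordinal.{u} → Multiset Ordinal.{u} → Prop) : Prop :=
  ∀ M N, R M N → ∀ N', Step N N' →
    (∃ N'', Step N' N'' ∧ R N'' M) ∨ ∃ M', Step M M' ∧ R M' N'

/-- A relation that passes the recursive test, and that relates the empty position only to itself,
does not relate different positions: no Nim position has a reversible option. -/
theorem nonzero_eq_of_reversibleOrMatched
    {R : Multiset Ordinal.{u} → Multiset Ordinal.{u} → Prop} (hR : ReversibleOrMatched R)
    (hsymm : ∀ M N, R M N → R N M) (hzero : ∀ M N, R M N → nonzero M = 0 → nonzero N = 0)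
    {M N : Multiset Ordinal.{u}} (h : R M N) : nonzero M = nonzero N := by
  obtain ⟨S, hS⟩ : ∃ S, S = nonzero M + nonzero N := ⟨_, rfl⟩
  induction S using isDershowitzMannaLT_induction generalizing M N with
  | _ S ih =>
    subst hS
    -- A reversible option contradicts the induction hypothesis.
    have key : ∀ M N, (∀ M' N', R M' N' → (nonzero M' + nonzero N').IsDershowitzMannaLT
          (nonzero M + nonzero N) → nonzero M' = nonzero N') → R M N →
        ∀ N' N'', Step N N' → Step N' N'' → ¬ R N'' M := by
      intro M N ih h N' N'' h1 h2 h3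
      have e1 : nonzero N'' = nonzero M := ih _ _ h3 (by
        rw [add_comm (nonzero M)]
        exact (h2.isDershowitzMannaLT.trans h1.isDershowitzMannaLT).add_right _)
      have hlt : (nonzero M).IsDershowitzMannaLT (nonzero N) :=
        e1 ▸ h2.isDershowitzMannaLT.trans h1.isDershowitzMannaLT
      have hM : nonzero M ≠ 0 := fun h0 => h1.nonzero_ne_zero (hzero M N h h0)
      have hsub : OptionsSubset M N := by
        intro M' hM'
        rcases hR N M (hsymm _ _ h) M' hM' with ⟨M'', hM'', hr⟩ | ⟨N₁, hN₁, hr⟩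
        · have hlt' := hM''.isDershowitzMannaLT.trans hM'.isDershowitzMannaLT
          have e2 := ih _ _ hr (hlt'.add_right _)
          exact absurd ((e2 ▸ hlt').trans hlt) (isDershowitzMannaLT_irrefl _)
        · refine ⟨N₁, hN₁, ?_⟩
          refine (ih _ _ hr ?_).symm
          rw [add_comm]
          exact hM'.isDershowitzMannaLT.add hN₁.isDershowitzMannaLT
      obtain ⟨N₁, hN₁, e3⟩ := hsub.exists_step hM h1 h2 e1.symm
      rcases hR M N h N₁ hN₁ with ⟨N₂, hN₂, hr⟩ | ⟨M', hM', hr⟩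
      · have e4 := ih _ _ hr (by
          rw [add_comm (nonzero M)]
          exact (hN₂.isDershowitzMannaLT.trans hN₁.isDershowitzMannaLT).add_right _)
        exact isDershowitzMannaLT_irrefl _ ((e4.trans e3) ▸ hN₂.isDershowitzMannaLT)
      · have e4 := ih _ _ hr (hM'.isDershowitzMannaLT.add hN₁.isDershowitzMannaLT)
        exact isDershowitzMannaLT_irrefl _ ((e4.trans e3.symm) ▸ hM'.isDershowitzMannaLT)
    have ih' : ∀ M' N', R M' N' → (nonzero M' + nonzero N').IsDershowitzMannaLT
        (nonzero M + nonzero N) → nonzero M' = nonzero N' := fun M' N' hr hlt =>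
      ih _ hlt hr rfl
    refine nonzero_eq_of_optionsSubset (fun M' hM' => ?_) (fun N' hN' => ?_)
    · rcases hR N M (hsymm _ _ h) M' hM' with ⟨M'', hM'', hr⟩ | ⟨N₁, hN₁, hr⟩
      · rw [add_comm] at ih'
        exact absurd hr (key N M ih' (hsymm _ _ h) _ _ hM' hM'')
      · refine ⟨N₁, hN₁, (ih' _ _ hr ?_).symm⟩
        rw [add_comm]
        exact hM'.isDershowitzMannaLT.add hN₁.isDershowitzMannaLT
    · rcases hR M N h N' hN' with ⟨N'', hN'', hr⟩ | ⟨M₁, hM₁, hr⟩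
      · exact absurd hr (key M N ih' h _ _ hN' hN'')
      · exact ⟨M₁, hM₁, (ih' _ _ hr (hM₁.isDershowitzMannaLT.add hN'.isDershowitzMannaLT)).symm⟩

/-- The Nim position of a multiset of heap sizes, listed in an arbitrary order. -/
noncomputable def nimOf (M : Multiset Ordinal.{u}) : Game.{u} := nim M.toList

theorem nimOf_coe_iso (A : List Ordinal.{u}) :
    Iso (nimOf (A : Multiset Ordinal.{u})) (nim A) :=
  nim_iso_of_perm (Multiset.coe_eq_coe.1 (Multiset.coe_toList _))

theorem isImpartial_nimOf (M : Multiset Ordinal.{u}) : (nimOf M).IsImpartial :=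
  isImpartial_nim _

theorem nimOf_iso_zero_iff {M : Multiset Ordinal.{u}} : Iso (nimOf M) 0 ↔ nonzero M = 0 := by
  rw [nimOf, nim_iso_zero_iff, Multiset.coe_toList]

/-- An equivalence relation on games that contains isomorphism and obeys the recursive test on
impartial games obeys it on multisets of heap sizes. -/
theorem reversibleOrMatched_nimOf {E : Game.{u} → Game.{u} → Prop}
    (htrans : ∀ {G H K}, E G H → E H K → E G K) (hiso : ∀ {G H}, Iso G H → E G H)
    (hopt : ∀ {G H}, G.IsImpartial → H.IsImpartial → E G H → ∀ {y}, y ∈ H.options →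
      (∃ z ∈ y.options, E z G) ∨ ∃ x ∈ G.options, E x y) :
    ReversibleOrMatched fun M N => E (nimOf M) (nimOf N) := by
  intro M N h N' hN'
  rw [← Multiset.coe_toList N] at hN'
  obtain ⟨B, rfl, hB⟩ := exists_option_of_step hN'
  rcases hopt (isImpartial_nimOf M) (isImpartial_nimOf N) h hB with ⟨z, hz, hzM⟩ | ⟨x, hx, hxB⟩
  · obtain ⟨C, rfl, hC⟩ := exists_step_of_mem_options hz
    exact Or.inl ⟨C, hC, htrans (hiso (nimOf_coe_iso C)) hzM⟩
  · obtain ⟨C, rfl, hC⟩ := exists_step_of_mem_options hx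
    rw [Multiset.coe_toList] at hC
    exact Or.inr ⟨C, hC, htrans (htrans (hiso (nimOf_coe_iso C)) hxB)
      (hiso (nimOf_coe_iso B).symm)⟩

theorem nonzero_eq_of_partEquiv {A B : List Ordinal.{u}} (h : PartEquiv (nim A) (nim B)) :
    nonzero (A : Multiset Ordinal.{u}) = nonzero (B : Multiset Ordinal.{u}) := by
  refine nonzero_eq_of_reversibleOrMatched (R := fun M N => PartEquiv (nimOf M) (nimOf N))
    (reversibleOrMatched_nimOf PartEquiv.trans Iso.partEquiv PartEquiv.exists_of_option)
    (fun _ _ => PartEquiv.symm) (fun M N h hM => ?_) ?_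
  · rw [← nimOf_iso_zero_iff] at hM ⊢
    exact (h.iso_zero_iff (isImpartial_nimOf M) (isImpartial_nimOf N)).1 hM
  · exact (nimOf_coe_iso A).partEquiv.trans (h.trans (nimOf_coe_iso B).symm.partEquiv)

theorem nim_iso_iff {A B : List Ordinal.{u}} :
    Iso (nim A) (nim B) ↔
      nonzero (A : Multiset Ordinal.{u}) = nonzero (B : Multiset Ordinal.{u}) :=
  ⟨fun h => nonzero_eq_of_partEquiv h.partEquiv, nim_iso_of_nonzero_eq⟩

theorem nim_partEquiv_iff {A B : List Ordinal.{u}} :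
    PartEquiv (nim A) (nim B) ↔ Iso (nim A) (nim B) :=
  ⟨fun h => nim_iso_of_nonzero_eq (nonzero_eq_of_partEquiv h), Iso.partEquiv⟩

/-! ### Halves and parity -/

/-- The heap sizes `m` of the even parts `2 * m` of the heaps of a position. -/
noncomputable def halves (M : Multiset Ordinal.{u}) : Multiset Ordinal.{u} := M.map (· / 2)

/-- The number of odd heaps of a position. -/
noncomputable def oddCount (M : Multiset Ordinal.{u}) : ℕ := (M.filter OddSize).card

/-- The invariant of a Nim position under impartial equivalence: the nonzero halves of the heap
sizes, together with an entry `0` if the number of odd heaps is odd. With this encoding of the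
parity, moves from positions with at most one odd heap lower the invariant in the
Dershowitz–Manna order. -/
noncomputable def nimClass (M : Multiset Ordinal.{u}) : Multiset Ordinal.{u} :=
  nonzero (halves M) + Multiset.replicate (oddCount M % 2) 0

/-- The position with a given invariant that has only even heaps and possibly a heap of size
one. -/
noncomputable def ofClass (S : Multiset Ordinal.{u}) : Multiset Ordinal.{u} :=
  S.map fun e => if e = 0 then 1 else 2 * e

@[simp]
theorem halves_cons (a : Ordinal.{u}) (M : Multiset Ordinal.{u}) :
    halves (a ::ₘ M) = a / 2 ::ₘ halves M :=
  Multiset.map_cons _ _ _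

@[simp]
theorem oddCount_cons (a : Ordinal.{u}) (M : Multiset Ordinal.{u}) :
    oddCount (a ::ₘ M) = oddCount M + if OddSize a then 1 else 0 := by
  rw [oddCount, Multiset.filter_cons]
  split_ifs <;> simp [oddCount, add_comm]

@[simp]
theorem oddCount_zero : oddCount (0 : Multiset Ordinal.{u}) = 0 := rfl

theorem nonzero_nimClass (M : Multiset Ordinal.{u}) :
    nonzero (nimClass M) = nonzero (halves M) := by
  rw [nonzero_eq_iff]
  intro x hx
  simp [nimClass, nonzero, Multiset.count_replicate, hx, hx.symm]

theorem count_zero_nimClass (M : Multiset Ordinal.{u}) :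
    (nimClass M).count 0 = oddCount M % 2 := by
  simp [nimClass, nonzero]

theorem nimClass_eq_iff {M N : Multiset Ordinal.{u}} :
    nimClass M = nimClass N ↔
      nonzero (halves M) = nonzero (halves N) ∧ oddCount M % 2 = oddCount N % 2 := by
  refine ⟨fun h => ⟨?_, ?_⟩, fun ⟨h1, h2⟩ => by rw [nimClass, nimClass, h1, h2]⟩
  · rw [← nonzero_nimClass, h, nonzero_nimClass]
  · rw [← count_zero_nimClass, h, count_zero_nimClass]

theorem halves_ofClass (S : Multiset Ordinal.{u}) : halves (ofClass S) = S := by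
  rw [halves, ofClass, Multiset.map_map]
  conv_rhs => rw [← Multiset.map_id S]
  refine Multiset.map_congr rfl fun e _ => ?_
  by_cases he : e = 0
  · simp [he, Ordinal.div_eq_zero_of_lt (one_lt_two : (1 : Ordinal.{u}) < 2)]
  · simp [he]

theorem oddSize_one : OddSize (1 : Ordinal.{u}) := by
  simpa using oddSize_two_mul_add_one 0

theorem oddCount_ofClass (S : Multiset Ordinal.{u}) : oddCount (ofClass S) = S.count 0 := by
  induction S using Multiset.induction with
  | empty => rfl
  | cons e S ih =>
    rw [ofClass, Multiset.map_cons, oddCount_cons, Multiset.count_cons]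
    congr 1
    by_cases he : e = 0
    · simp [he, oddSize_one]
    · simp [he, Ne.symm he, not_oddSize_two_mul]

theorem nimClass_ofClass (M : Multiset Ordinal.{u}) :
    nimClass (ofClass (nimClass M)) = nimClass M := by
  rw [nimClass_eq_iff, halves_ofClass, oddCount_ofClass, nonzero_nimClass, count_zero_nimClass,
    Nat.mod_mod]
  exact ⟨rfl, rfl⟩

theorem oddCount_ofClass_nimClass_le (M : Multiset Ordinal.{u}) :
    oddCount (ofClass (nimClass M)) ≤ 1 := by
  rw [oddCount_ofClass, count_zero_nimClass]
  omega

/-! ### Moves and the invariant -/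

/-- A move either lowers a half, or turns an odd heap into the even heap with the same half. -/
theorem Step.halves {M N : Multiset Ordinal.{u}} (h : Step M N) :
    Step (halves M) (halves N) ∨ (MisereNim.halves M = MisereNim.halves N ∧
      oddCount M = oddCount N + 1) := by
  obtain ⟨a, b, C, hb, rfl, rfl⟩ := h
  simp only [halves_cons, oddCount_cons]
  rcases (Ordinal.div_le_left hb.le 2).lt_or_eq with hlt | heq
  · exact Or.inl ⟨_, _, _, hlt, rfl, rfl⟩
  · refine Or.inr ⟨by rw [heq], ?_⟩
    by_cases ha : OddSize a
    · by_cases hb' : OddSize b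
      · rw [eq_of_oddSize ha, eq_of_oddSize hb', heq] at hb
        exact absurd hb (lt_irrefl _)
      · simp [ha, hb']
    · by_cases hb' : OddSize b
      · rw [eq_of_not_oddSize ha, eq_of_oddSize hb', heq] at hb
        exact absurd hb (not_lt_of_ge (lt_add_one _).le)
      · rw [eq_of_not_oddSize ha, eq_of_not_oddSize hb', heq] at hb
        exact absurd hb (lt_irrefl _)

/-- A move that lowers a half may leave any parity. -/
theorem Step.exists_of_halves {M E : Multiset Ordinal.{u}} (h : Step (MisereNim.halves M) E)
    {i : ℕ} (hi : i < 2) :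
    ∃ N, Step M N ∧ MisereNim.halves N = E ∧ oddCount N % 2 = i := by
  obtain ⟨m, k, C, hk, hM, rfl⟩ := h
  obtain ⟨a, ha, rfl⟩ := Multiset.mem_map.1 (hM ▸ Multiset.mem_cons_self m C)
  obtain ⟨D, rfl⟩ := Multiset.exists_cons_of_mem ha
  rw [halves_cons, Multiset.cons_inj_right] at hM
  subst hM
  have ha : 2 * (a / 2) ≤ a := Ordinal.mul_div_le a 2
  by_cases hD : oddCount D % 2 = i
  · refine ⟨2 * k ::ₘ D, ⟨a, _, D, (two_mul_lt_two_mul hk).trans_le ha, rfl, rfl⟩, ?_, ?_⟩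
    · rw [halves_cons, two_mul_div_two]
    · simpa [not_oddSize_two_mul] using hD
  · refine ⟨(2 * k + 1) ::ₘ D, ⟨a, _, D, (two_mul_add_one_lt_two_mul hk).trans_le ha, rfl, rfl⟩,
      ?_, ?_⟩
    · rw [halves_cons, two_mul_add_one_div_two]
    · simp only [oddCount_cons, oddSize_two_mul_add_one, if_true]
      omega

theorem exists_step_of_oddCount {M : Multiset Ordinal.{u}} (h : oddCount M ≠ 0) :
    ∃ N, Step M N ∧ halves N = halves M ∧ oddCount M = oddCount N + 1 := by
  obtain ⟨a, ha⟩ := Multiset.exists_mem_of_ne_zero fun h0 => h (Multiset.card_eq_zero.2 h0)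
  obtain ⟨ha, hodd⟩ := Multiset.mem_filter.1 ha
  obtain ⟨D, rfl⟩ := Multiset.exists_cons_of_mem ha
  have hlt : 2 * (a / 2) < a := by
    conv_rhs => rw [eq_of_oddSize hodd]
    exact lt_add_one _
  refine ⟨2 * (a / 2) ::ₘ D, ⟨a, _, D, hlt, rfl, rfl⟩, ?_, ?_⟩
  · rw [halves_cons, halves_cons, two_mul_div_two]
  · simp [not_oddSize_two_mul, hodd]

theorem isDershowitzMannaLT_nimClass_of_halves {M N : Multiset Ordinal.{u}}
    (h : (nonzero (halves N)).IsDershowitzMannaLT (nonzero (halves M))) :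
    (nimClass N).IsDershowitzMannaLT (nimClass M) := by
  obtain ⟨X, Y, Z, hZ, hN, hM, hlt⟩ := h
  obtain ⟨z, hz⟩ := Multiset.exists_mem_of_ne_zero hZ
  have hz0 : z ≠ 0 :=
    ne_zero_of_mem_nonzero (M := halves M) (hM ▸ Multiset.mem_add.2 (Or.inr hz))
  refine ⟨X, Y + Multiset.replicate (oddCount N % 2) 0, Z + Multiset.replicate (oddCount M % 2) 0,
    fun h0 => hZ (add_eq_zero.1 h0).1, ?_, ?_, fun y hy => ?_⟩
  · rw [nimClass, hN, add_assoc]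
  · rw [nimClass, hM, add_assoc]
  · rcases Multiset.mem_add.1 hy with hy | hy
    · obtain ⟨w, hw, hyw⟩ := hlt y hy
      exact ⟨w, Multiset.mem_add.2 (Or.inl hw), hyw⟩
    · rw [Multiset.eq_of_mem_replicate hy]
      exact ⟨z, Multiset.mem_add.2 (Or.inl hz), pos_iff_ne_zero.2 hz0⟩

theorem Step.isDershowitzMannaLT_nimClass {M N : Multiset Ordinal.{u}} (h : Step M N)
    (hM : oddCount M ≤ 1) : (nimClass N).IsDershowitzMannaLT (nimClass M) := by
  rcases h.halves with h | ⟨h1, h2⟩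
  · exact isDershowitzMannaLT_nimClass_of_halves h.isDershowitzMannaLT
  · have h3 : oddCount N = 0 := by omega
    have h4 : oddCount M = 1 := by omega
    refine ⟨nonzero (MisereNim.halves M), 0, {0}, by simp, ?_, ?_, by simp⟩
    · simp [nimClass, h3, h1]
    · simp [nimClass, h4]

theorem Step.isDershowitzMannaLT_nimClass_of_step {M N K : Multiset Ordinal.{u}} (h : Step M N)
    (h' : Step N K) (hM : oddCount M ≤ 1) :
    (nimClass K).IsDershowitzMannaLT (nimClass M) := by
  rcases h.halves with h1 | ⟨h1, h2⟩
  · refine isDershowitzMannaLT_nimClass_of_halves ?_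
    rcases h'.halves with h3 | ⟨h3, -⟩
    · exact h3.isDershowitzMannaLT.trans h1.isDershowitzMannaLT
    · exact h3 ▸ h1.isDershowitzMannaLT
  · exact (h'.isDershowitzMannaLT_nimClass (by omega)).trans (h.isDershowitzMannaLT_nimClass hM)

theorem Step.nimClass_ne {M N : Multiset Ordinal.{u}} (h : Step M N) :
    nimClass N ≠ nimClass M := by
  rw [Ne, nimClass_eq_iff]
  rintro ⟨h1, h2⟩
  rcases h.halves with h3 | ⟨-, h3⟩
  · exact isDershowitzMannaLT_irrefl _ (h1 ▸ h3.isDershowitzMannaLT)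
  · omega

theorem Step.card_nonzero_le {M N : Multiset Ordinal.{u}} (h : Step M N) :
    (nonzero M).card ≤ (nonzero N).card + 1 := by
  obtain ⟨a, b, C, hb, rfl, rfl⟩ := h
  rw [nonzero_cons_of_ne (ne_bot_of_gt hb), Multiset.card_cons]
  exact Nat.succ_le_succ (card_nonzero_cons_le b C)

/-! ### Comparing invariants of equivalent positions -/

/-- If the options of `M` have the invariants of options of `N`, then the halves of `M` and `N`
satisfy the same inclusion: a move in the halves may be given odd parity, and then the matching
move of `N` has to lower a half, too. -/
theorem optionsSubset_halves {M N : Multiset Ordinal.{u}}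
    (h : ∀ M', Step M M' → ∃ N', Step N N' ∧ nimClass M' = nimClass N') (hN : oddCount N ≤ 1) :
    OptionsSubset (halves M) (halves N) := by
  intro E hE
  obtain ⟨M', hM', rfl, hi⟩ := hE.exists_of_halves (i := 1) one_lt_two
  obtain ⟨N', hN', hMN⟩ := h M' hM'
  obtain ⟨h1, h2⟩ := nimClass_eq_iff.1 hMN
  rcases hN'.halves with h3 | ⟨-, h3⟩
  · exact ⟨_, h3, h1⟩
  · omega

theorem nimClass_eq_of_options {M N : Multiset Ordinal.{u}}
    (h : ∀ M', Step M M' → ∃ N', Step N N' ∧ nimClass M' = nimClass N')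
    (h' : ∀ N', Step N N' → ∃ M', Step M M' ∧ nimClass N' = nimClass M')
    (hM : oddCount M ≤ 1) (hN : oddCount N ≤ 1) : nimClass M = nimClass N := by
  have hE : nonzero (halves M) = nonzero (halves N) :=
    nonzero_eq_of_optionsSubset (optionsSubset_halves h hN) (optionsSubset_halves h' hM)
  refine nimClass_eq_iff.2 ⟨hE, ?_⟩
  -- If the parities differ, the position with an odd heap has an option with the invariant of
  -- the other position, which then would be an option of itself.
  have key : ∀ {M N : Multiset Ordinal.{u}}, nonzero (halves M) = nonzero (halves N) →
      (∀ M', Step M M' → ∃ N', Step N N' ∧ nimClass M' = nimClass N') →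
      oddCount M = 1 → oddCount N ≠ 0 := by
    intro M N hE h hM hN
    obtain ⟨M', hM', h1, h2⟩ := exists_step_of_oddCount (M := M) (by omega)
    obtain ⟨N', hN', h3⟩ := h M' hM'
    refine hN'.nimClass_ne (h3.symm.trans (nimClass_eq_iff.2 ⟨by rw [h1, hE], ?_⟩))
    omega
  have k1 := key hE h
  have k2 := key hE.symm h'
  omega

/-- If `M` has the invariant of a position two moves below `N`, but not that of an option of `N`,
and if all options of `M` have invariants of options of `N`, then `M` has the invariant of the empty
position. -/
theorem nimClass_eq_zero_of_reversible {M N N' N'' : Multiset Ordinal.{u}}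
    (h : ∀ M', Step M M' → ∃ N', Step N N' ∧ nimClass M' = nimClass N')
    (hM : oddCount M ≤ 1) (hN : oddCount N ≤ 1) (h1 : Step N N') (h2 : Step N' N'')
    (h3 : nimClass N'' = nimClass M) (hne : ∀ F, Step N F → nimClass F ≠ nimClass M) :
    nimClass M = 0 := by
  obtain ⟨e1, e2⟩ := nimClass_eq_iff.1 h3
  have hno : ∀ F, Step (halves N) F → nonzero F ≠ nonzero (halves M) := by
    intro F hF hFM
    obtain ⟨K, hK, rfl, hKi⟩ := hF.exists_of_halves (Nat.mod_lt (oddCount M) two_pos)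
    exact hne K hK (nimClass_eq_iff.2 ⟨hFM, hKi⟩)
  by_cases hE : nonzero (halves M) = 0
  · by_contra h0
    have hM1 : oddCount M = 1 := by
      by_contra hM0
      have : oddCount M = 0 := by omega
      exact h0 (by simp [nimClass, hE, this])
    obtain ⟨M', hM', h4, h5⟩ := exists_step_of_oddCount (M := M) (by omega)
    obtain ⟨N₁, hN₁, h6⟩ := h M' hM'
    obtain ⟨h7, h8⟩ := nimClass_eq_iff.1 h6
    rcases hN₁.halves with h9 | ⟨h9, h10⟩
    · exact hno _ h9 (by rw [← h7, h4])
    · refine isDershowitzMannaLT_irrefl (nimClass N) ?_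
      have h11 := h1.isDershowitzMannaLT_nimClass_of_step h2 hN
      rwa [h3, nimClass_eq_iff.2 ⟨by rw [h9, ← h7, h4], by omega⟩] at h11
  · exfalso
    rcases h1.halves with h4 | ⟨h4, h5⟩
    · rcases h2.halves with h6 | ⟨h6, -⟩
      · obtain ⟨F, hF, hFM⟩ := (optionsSubset_halves h hN).exists_step hE h4 h6 e1.symm
        exact hno F hF hFM.symm
      · exact hno _ h4 (h6 ▸ e1)
    · rcases h2.halves with h6 | ⟨-, h6⟩
      · exact hno _ (h4 ▸ h6) e1
      · omega

/-- The only position that could be equivalent to the empty one through reversible options alone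
consists of two heaps of size two. -/
theorem eq_two_two_of_reversible {N : Multiset Ordinal.{u}} (hN : N = ofClass (nimClass N))
    (hstep : ∃ N', Step N N')
    (h : ∀ N', Step N N' → nimClass N' ≠ 0 ∧ ∃ N'', Step N' N'' ∧ nimClass N'' = 0) :
    N = {2, 2} := by
  have hodd : oddCount N ≤ 1 := by
    rw [hN]; exact oddCount_ofClass_nimClass_le N
  have hcls : ∀ {K : Multiset Ordinal.{u}}, nimClass K = 0 ↔
      nonzero (halves K) = 0 ∧ oddCount K % 2 = 0 := fun {K} => nimClass_eq_iff (N := 0)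
  have hcard : ∀ N', Step N N' → (nonzero (halves N')).card ≤ 1 := by
    intro N' hN'
    obtain ⟨-, N'', hN'', h0⟩ := h N' hN'
    rw [hcls] at h0
    rcases hN''.halves with h1 | ⟨h1, -⟩
    · simpa [h0.1] using h1.card_nonzero_le
    · simp [h1, h0.1]
  have hstep' : ∀ m ∈ nonzero (halves N), ∃ D, halves N = m ::ₘ D ∧ m ≠ 0 := fun m hm => by
    obtain ⟨D, hD⟩ := Multiset.exists_cons_of_mem (Multiset.mem_filter.1 hm).1
    exact ⟨D, hD, ne_zero_of_mem_nonzero hm⟩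
  -- A single nonzero half could be removed at once, leaving an even number of odd heaps.
  have hne1 : (nonzero (halves N)).card ≠ 1 := by
    intro h1
    obtain ⟨m, hm⟩ := Multiset.card_eq_one.1 h1
    obtain ⟨D, hD, hm0⟩ := hstep' m (by simp [hm])
    rw [hD, nonzero_cons_of_ne hm0, Multiset.card_cons, Nat.add_eq_right,
      Multiset.card_eq_zero] at h1
    have hs : Step (halves N) (0 ::ₘ D) := ⟨m, 0, D, pos_iff_ne_zero.2 hm0, hD, rfl⟩
    obtain ⟨N', hN', h2, h3⟩ := hs.exists_of_halves (i := 0) two_pos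
    exact (h N' hN').1 (hcls.2 ⟨by rw [h2, nonzero_zero_cons, h1], h3⟩)
  have hodd0 : oddCount N = 0 := by
    by_contra h0
    obtain ⟨N', hN', h1, h2⟩ := exists_step_of_oddCount h0
    have h3 := hcard N' hN'
    rw [h1] at h3
    have h4 : nonzero (halves N) = 0 := Multiset.card_eq_zero.1 (by omega)
    exact (h N' hN').1 (hcls.2 ⟨by rw [h1, h4], by omega⟩)
  have hclsN : nimClass N = nonzero (halves N) := by simp [nimClass, hodd0]
  have hne0 : nonzero (halves N) ≠ 0 := by
    intro h0
    obtain ⟨N', hN'⟩ := hstep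
    rw [hclsN, h0] at hN
    rw [hN] at hN'
    exact hN'.nonzero_ne_zero rfl
  have hpos : 0 < (nonzero (halves N)).card := Multiset.card_pos.2 hne0
  -- Otherwise there are two nonzero halves, and neither may be lowered to a nonzero one.
  have hmem : ∀ m ∈ nonzero (halves N), m = 1 ∧ (nonzero (halves N)).card = 2 := by
    intro m hm
    obtain ⟨D, hD, hm0⟩ := hstep' m hm
    have hc : (nonzero (halves N)).card = (nonzero D).card + 1 := by
      rw [hD, nonzero_cons_of_ne hm0, Multiset.card_cons]
    have hlow : ∀ k < m, (nonzero (k ::ₘ D)).card ≤ 1 := by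
      intro k hk
      have hs : Step (halves N) (k ::ₘ D) := ⟨m, k, D, hk, hD, rfl⟩
      obtain ⟨N', hN', h2, -⟩ := hs.exists_of_halves (i := 0) two_pos
      rw [← h2]
      exact hcard N' hN'
    have h1 := hlow 0 (pos_iff_ne_zero.2 hm0)
    rw [nonzero_zero_cons] at h1
    refine ⟨?_, by omega⟩
    by_contra hm1
    have h2 := hlow 1 (lt_of_le_of_ne (Order.one_le_iff_pos.2 (pos_iff_ne_zero.2 hm0))
      (Ne.symm hm1))
    rw [nonzero_cons_of_ne one_ne_zero, Multiset.card_cons] at h2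
    omega
  obtain ⟨m, hm⟩ := Multiset.exists_mem_of_ne_zero hne0
  have hE : nonzero (halves N) = {1, 1} :=
    Multiset.eq_replicate.2 ⟨(hmem m hm).2, fun b hb => (hmem b hb).1⟩
  rw [hN, hclsN, hE]
  simp [ofClass]

/-- A relation that passes the recursive test, that relates positions with the same invariant, and
that does not relate the empty position to two heaps of size two, relates only positions with the
same invariant. -/
theorem nimClass_eq_of_reversibleOrMatched
    {R : Multiset Ordinal.{u} → Multiset Ordinal.{u} → Prop} (hR : ReversibleOrMatched R)
    (hsymm : ∀ M N, R M N → R N M) (htrans : ∀ M N K, R M N → R N K → R M K)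
    (hclass : ∀ M N, nimClass M = nimClass N → R M N) (hzero : ¬ R 0 {2, 2})
    {M N : Multiset Ordinal.{u}} (h : R M N) : nimClass M = nimClass N := by
  obtain ⟨S, hS⟩ : ∃ S, S = nimClass M + nimClass N := ⟨_, rfl⟩
  induction S using isDershowitzMannaLT_induction generalizing M N with
  | _ S ih =>
    subst hS
    replace ih : ∀ M' N', R M' N' → (nimClass M' + nimClass N').IsDershowitzMannaLT
        (nimClass M + nimClass N) → nimClass M' = nimClass N' := fun M' N' hr hlt =>
      ih _ hlt hr rfl
    -- The two positions may be replaced by standard ones with the same invariants.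
    replace h : R (ofClass (nimClass M)) (ofClass (nimClass N)) :=
      htrans _ _ _ (hclass _ _ (nimClass_ofClass M)) (htrans _ _ _ h
        (hclass _ _ (nimClass_ofClass N).symm))
    rw [← nimClass_ofClass M, ← nimClass_ofClass N] at ih ⊢
    have hMs : ofClass (nimClass M) = ofClass (nimClass (ofClass (nimClass M))) := by
      rw [nimClass_ofClass]
    have hNs : ofClass (nimClass N) = ofClass (nimClass (ofClass (nimClass N))) := by
      rw [nimClass_ofClass]
    have hMo := oddCount_ofClass_nimClass_le M
    have hNo := oddCount_ofClass_nimClass_le N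
    generalize ofClass (nimClass M) = M, ofClass (nimClass N) = N at *
    -- A reversible option contradicts the induction hypothesis.
    have key : ∀ M N : Multiset Ordinal.{u}, M = ofClass (nimClass M) → N = ofClass (nimClass N) →
        oddCount M ≤ 1 → oddCount N ≤ 1 →
        (∀ M' N', R M' N' → (nimClass M' + nimClass N').IsDershowitzMannaLT
          (nimClass M + nimClass N) → nimClass M' = nimClass N') → R M N →
        ∀ N' N'', Step N N' → Step N' N'' → ¬ R N'' M := by
      intro M N hMs hNs hMo hNo ih h N' N'' h1 h2 h3
      have ih2 : ∀ N' N'', Step N N' → Step N' N'' → R N'' M → nimClass N'' = nimClass M := by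
        intro N' N'' h1 h2 h3
        refine ih _ _ h3 ?_
        rw [add_comm (nimClass M)]
        exact (h1.isDershowitzMannaLT_nimClass_of_step h2 hNo).add_right _
      have e1 := ih2 _ _ h1 h2 h3
      have hlt : (nimClass M).IsDershowitzMannaLT (nimClass N) :=
        e1 ▸ h1.isDershowitzMannaLT_nimClass_of_step h2 hNo
      have hsub : ∀ M', Step M M' → ∃ N', Step N N' ∧ nimClass M' = nimClass N' := by
        intro M' hM'
        rcases hR N M (hsymm _ _ h) M' hM' with ⟨M'', hM'', hr⟩ | ⟨N₁, hN₁, hr⟩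
        · have hlt' := hM'.isDershowitzMannaLT_nimClass_of_step hM'' hMo
          have e2 := ih _ _ hr (hlt'.add_right _)
          exact absurd ((e2 ▸ hlt').trans hlt) (isDershowitzMannaLT_irrefl _)
        · refine ⟨N₁, hN₁, (ih _ _ hr ?_).symm⟩
          rw [add_comm]
          exact (hM'.isDershowitzMannaLT_nimClass hMo).add (hN₁.isDershowitzMannaLT_nimClass hNo)
      have hne : ∀ F, Step N F → nimClass F ≠ nimClass M := by
        intro F hF e3
        rcases hR M N h F hF with ⟨N₂, hN₂, hr⟩ | ⟨M', hM', hr⟩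
        · exact hN₂.nimClass_ne ((ih2 _ _ hF hN₂ hr).trans e3.symm)
        · have e4 := ih _ _ hr ((hM'.isDershowitzMannaLT_nimClass hMo).add
            (hF.isDershowitzMannaLT_nimClass hNo))
          exact hM'.nimClass_ne (e4.trans e3)
      have hM0 := nimClass_eq_zero_of_reversible hsub hMo hNo h1 h2 e1 hne
      have hM : M = 0 := by rw [hMs, hM0]; rfl
      have hN : N = {2, 2} := by
        refine eq_two_two_of_reversible hNs ⟨N', h1⟩ fun F hF => ⟨hM0 ▸ hne F hF, ?_⟩
        rcases hR M N h F hF with ⟨N₂, hN₂, hr⟩ | ⟨M', hM', -⟩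
        · exact ⟨N₂, hN₂, (ih2 _ _ hF hN₂ hr).trans hM0⟩
        · exact absurd (by rw [hM]; rfl) hM'.nonzero_ne_zero
      exact hzero (hM ▸ hN ▸ h)
    refine nimClass_eq_of_options (fun M' hM' => ?_) (fun N' hN' => ?_) hMo hNo
    · rcases hR N M (hsymm _ _ h) M' hM' with ⟨M'', hM'', hr⟩ | ⟨N₁, hN₁, hr⟩
      · rw [add_comm] at ih
        exact absurd hr (key N M hNs hMs hNo hMo ih (hsymm _ _ h) _ _ hM' hM'')
      · refine ⟨N₁, hN₁, (ih _ _ hr ?_).symm⟩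
        rw [add_comm]
        exact (hM'.isDershowitzMannaLT_nimClass hMo).add (hN₁.isDershowitzMannaLT_nimClass hNo)
    · rcases hR M N h N' hN' with ⟨N'', hN'', hr⟩ | ⟨M₁, hM₁, hr⟩
      · exact absurd hr (key M N hMs hNs hMo hNo ih h _ _ hN' hN'')
      · exact ⟨M₁, hM₁, (ih _ _ hr ((hM₁.isDershowitzMannaLT_nimClass hMo).add
          (hN'.isDershowitzMannaLT_nimClass hNo))).symm⟩

/-! ### Impartial equivalence of Nim positions -/

theorem xorOne_one : xorOne (1 : Ordinal.{u}) = 0 := by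
  simpa using xorOne_two_mul_add_one (0 : Ordinal.{u})

theorem heap_one_add_parity_impEquiv (n : ℕ) :
    ImpEquiv (heap (1 : Ordinal.{u}) + heap ((n % 2 : ℕ) : Ordinal.{u}))
      (heap (((n + 1) % 2 : ℕ) : Ordinal.{u})) := by
  rcases Nat.mod_two_eq_zero_or_one n with h | h
  · have h' : (n + 1) % 2 = 1 := by omega
    rw [h, h', Nat.cast_zero, Nat.cast_one]
    exact (add_heap_zero_iso _).impEquiv
  · have h' : (n + 1) % 2 = 0 := by omega
    rw [h, h', Nat.cast_zero, Nat.cast_one]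
    simpa only [xorOne_one] using heap_add_one_impEquiv (1 : Ordinal.{u})

/-- Every odd heap splits into an even heap and a heap of size one, and heaps of size one cancel
in pairs. -/
theorem nim_impEquiv_even_add_parity (A : List Ordinal.{u}) :
    ImpEquiv (nim A) (nim (A.map fun a => 2 * (a / 2)) +
      heap ((oddCount (A : Multiset Ordinal.{u}) % 2 : ℕ) : Ordinal.{u})) := by
  induction A with
  | nil =>
    refine (add_heap_zero_iso (nim [])).symm.impEquiv.trans ?_
    simpa using (Iso.refl _).impEquiv
  | cons a A ih =>
    rw [nim_cons, List.map_cons, nim_cons, ← Multiset.cons_coe, oddCount_cons]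
    refine (ih.add_left (isImpartial_heap a)).trans ?_
    generalize hX : nim (A.map fun a => 2 * (a / 2)) = X
    have hXi : X.IsImpartial := hX ▸ isImpartial_nim _
    by_cases ha : OddSize a
    · rw [if_pos ha]
      generalize oddCount (A : Multiset Ordinal.{u}) = n
      have hsplit : ImpEquiv (heap a) (heap (2 * (a / 2)) + heap 1) := by
        have := (heap_add_one_impEquiv (2 * (a / 2))).symm
        rwa [xorOne_two_mul, ← eq_of_oddSize ha] at this
      have hn := isImpartial_heap ((n % 2 : ℕ) : Ordinal.{u})
      refine (hsplit.add_right (hXi.add hn)).trans ?_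
      -- `(e + 1) + (X + p)` is rearranged to `(e + X) + (1 + p)`.
      have hiso : ∀ e o p : Game.{u}, Iso ((e + o) + (X + p)) ((e + X) + (o + p)) :=
        fun e o p => (add_assoc_iso e o _).trans <| (((Iso.refl e).add
          ((add_assoc_iso o X p).symm.trans (((add_comm_iso o X).add (Iso.refl p)).trans
            (add_assoc_iso X o p)))).trans (add_assoc_iso e X _).symm)
      exact (hiso _ _ _).impEquiv.trans
        ((heap_one_add_parity_impEquiv n).add_left ((isImpartial_heap _).add hXi))
    · rw [if_neg ha, add_zero, ← eq_of_not_oddSize ha]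
      exact (add_assoc_iso _ _ _).symm.impEquiv

theorem nim_impEquiv_of_nimClass_eq {A B : List Ordinal.{u}}
    (h : nimClass (A : Multiset Ordinal.{u}) = nimClass (B : Multiset Ordinal.{u})) :
    ImpEquiv (nim A) (nim B) := by
  obtain ⟨h1, h2⟩ := nimClass_eq_iff.1 h
  refine (nim_impEquiv_even_add_parity A).trans
    (ImpEquiv.trans ?_ (nim_impEquiv_even_add_parity B).symm)
  rw [h2]
  refine ((nim_iso_of_nonzero_eq ?_).add (Iso.refl _)).impEquiv
  have hmap : ∀ C : List Ordinal.{u},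
      nonzero ((C.map fun a => 2 * (a / 2) : List Ordinal.{u}) : Multiset Ordinal.{u}) =
        (nonzero (halves (C : Multiset Ordinal.{u}))).map (2 * ·) := by
    intro C
    induction C with
    | nil => rfl
    | cons c C ih =>
      rw [List.map_cons, ← Multiset.cons_coe, ← Multiset.cons_coe, halves_cons]
      by_cases hc : c / 2 = 0
      · rw [hc, mul_zero, nonzero_zero_cons, nonzero_zero_cons, ih]
      · rw [nonzero_cons_of_ne hc, nonzero_cons_of_ne (mul_ne_zero two_ne_zero hc),
          Multiset.map_cons, ih]
  rw [hmap, hmap, h1]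

theorem nimOf_impEquiv_of_nimClass_eq {M N : Multiset Ordinal.{u}}
    (h : nimClass M = nimClass N) : ImpEquiv (nimOf M) (nimOf N) :=
  nim_impEquiv_of_nimClass_eq (by rwa [Multiset.coe_toList, Multiset.coe_toList])

/-- Two heaps of size two are a win for the previous player. -/
theorem not_leftWins_nim_two_two : ¬ (nim [(2 : Ordinal.{u}), 2]).LeftWins := by
  rw [(isImpartial_nim _).not_leftWins_iff]
  refine ⟨?_, fun x hx => ?_⟩
  · refine ⟨heap 0 + nim [2], add_mem_leftOptions_left ?_ _⟩
    rw [leftOptions_heap]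
    exact ⟨0, Set.mem_Iio.2 two_pos, rfl⟩
  obtain ⟨B, rfl, a, b, C, hb, h1, h2⟩ := exists_step_of_mem_options (left_mem_options hx)
  -- After a move the heaps are `b` and `2` with `b ≤ 1`; the reply leaves one heap of size one.
  have ha : a = 2 := by
    have : a ∈ (([2, 2] : List Ordinal.{u}) : Multiset Ordinal.{u}) := by
      rw [h1]; exact Multiset.mem_cons_self a C
    simpa using this
  subst ha
  rw [← Multiset.cons_coe, Multiset.cons_inj_right] at h1
  subst h1
  have hreply : ∃ c < (2 : Ordinal.{u}), nonzero ({c, b} : Multiset Ordinal.{u}) = {1} := by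
    by_cases hb0 : b = 0
    · refine ⟨1, one_lt_two, ?_⟩
      rw [Multiset.insert_eq_cons, nonzero_cons_of_ne one_ne_zero, hb0, ← Multiset.cons_zero,
        nonzero_zero_cons]
      rfl
    · refine ⟨0, two_pos, ?_⟩
      have hb1 : b = 1 := by
        rw [← one_add_one_eq_two, Order.lt_add_one_iff] at hb
        exact le_antisymm hb (Order.one_le_iff_pos.2 (pos_iff_ne_zero.2 hb0))
      rw [Multiset.insert_eq_cons, nonzero_zero_cons, hb1, ← Multiset.cons_zero,
        nonzero_cons_of_ne one_ne_zero]
      rfl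
  obtain ⟨c, hc, hnz⟩ := hreply
  have hs : Step (B : Multiset Ordinal.{u}) {c, b} :=
    ⟨2, c, {b}, hc, by rw [h2]; exact Multiset.cons_swap b 2 0, rfl⟩
  obtain ⟨D, hD, hDB⟩ := exists_option_of_step hs
  refine (isImpartial_nim B).leftWins_of_option hDB fun hw => not_leftWins_heap_one ?_
  rw [← (nim_singleton_iso 1).leftWins_iff, ← (nim_iso_of_nonzero_eq (A := D) ?_).leftWins_iff]
  · exact hw
  · rw [hD, hnz, Multiset.coe_singleton, ← Multiset.cons_zero, nonzero_cons_of_ne one_ne_zero]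
    rfl

theorem nimClass_eq_of_impEquiv {A B : List Ordinal.{u}} (h : ImpEquiv (nim A) (nim B)) :
    nimClass (A : Multiset Ordinal.{u}) = nimClass (B : Multiset Ordinal.{u}) := by
  refine nimClass_eq_of_reversibleOrMatched (R := fun M N => ImpEquiv (nimOf M) (nimOf N))
    (reversibleOrMatched_nimOf ImpEquiv.trans Iso.impEquiv ImpEquiv.exists_of_option)
    (fun _ _ => ImpEquiv.symm) (fun _ _ _ => ImpEquiv.trans)
    (fun _ _ => nimOf_impEquiv_of_nimClass_eq) (fun h => ?_) ?_
  · have h1 := h.outcome_of_iso_zero (nimOf_iso_zero_iff.2 rfl)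
    rw [(isImpartial_nimOf _).outcome_eq_N_iff] at h1
    exact not_leftWins_nim_two_two ((nimOf_coe_iso [2, 2]).leftWins_iff.1 h1)
  · exact (nimOf_coe_iso A).impEquiv.trans (h.trans (nimOf_coe_iso B).symm.impEquiv)

/-! ### Reduced forms -/

theorem halves_add (M N : Multiset Ordinal.{u}) : halves (M + N) = halves M + halves N :=
  Multiset.map_add _ _ _

theorem oddCount_add (M N : Multiset Ordinal.{u}) :
    oddCount (M + N) = oddCount M + oddCount N := by
  simp [oddCount, Multiset.filter_add]

theorem oddCount_eq_zero_iff {M : Multiset Ordinal.{u}} :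
    oddCount M = 0 ↔ ∀ a ∈ M, ¬ OddSize a := by
  rw [oddCount, Multiset.card_eq_zero, Multiset.filter_eq_nil]

theorem not_oddSize_pred {a : Ordinal.{u}} (h : OddSize a) : ¬ OddSize a.pred := by
  rw [pred_of_oddSize h]; exact not_oddSize_two_mul _

theorem pred_div_two {a : Ordinal.{u}} (h : OddSize a) : a.pred / 2 = a / 2 := by
  rw [pred_of_oddSize h, two_mul_div_two]

theorem oddSize_add_one {a : Ordinal.{u}} (h : ¬ OddSize a) : OddSize (a + 1) := by
  rw [eq_of_not_oddSize h]; exact oddSize_two_mul_add_one _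

theorem add_one_div_two {a : Ordinal.{u}} (h : ¬ OddSize a) : (a + 1) / 2 = a / 2 := by
  conv_lhs => rw [eq_of_not_oddSize h]
  exact two_mul_add_one_div_two _

theorem halves_lowerPairs_and_oddCount (l : List Ordinal.{u}) (h : ∀ a ∈ l, OddSize a) :
    halves (lowerPairs l : Multiset Ordinal.{u}) = halves (l : Multiset Ordinal.{u}) ∧
      oddCount (lowerPairs l : Multiset Ordinal.{u}) = l.length % 2 := by
  induction l using List.twoStepInduction with
  | nil => exact ⟨rfl, rfl⟩
  | singleton a =>
    have ha : OddSize a := h a (by simp)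
    refine ⟨rfl, ?_⟩
    rw [lowerPairs, ← Multiset.cons_coe, oddCount_cons, if_pos ha]
    · rfl
    · simp
  | cons_cons a b l ih _ =>
    have ha : OddSize a := h a (by simp)
    have hb : OddSize b := h b (by simp)
    obtain ⟨h1, h2⟩ := ih fun c hc => h c (by simp [hc])
    rw [lowerPairs]
    simp only [← Multiset.cons_coe, halves_cons, oddCount_cons, h1, h2, pred_div_two ha,
      pred_div_two hb, if_neg (not_oddSize_pred ha), if_neg (not_oddSize_pred hb),
      List.length_cons, true_and]
    omega

theorem nimClass_reduceOddPairs (s : Multiset Ordinal.{u}) :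
    nimClass (reduceOddPairs s) = nimClass s ∧ oddCount (reduceOddPairs s) ≤ 1 := by
  have hodd : ∀ a ∈ (s.filter fun a => OddSize a).sort, OddSize a := fun a ha =>
    (Multiset.mem_filter.1 ((Multiset.mem_sort _).1 ha)).2
  obtain ⟨h1, h2⟩ := halves_lowerPairs_and_oddCount _ hodd
  have heven : oddCount (s.filter fun a => ¬ OddSize a) = 0 :=
    oddCount_eq_zero_iff.2 fun a ha => (Multiset.mem_filter.1 ha).2
  have hcount : oddCount (reduceOddPairs s) = oddCount s % 2 := by
    rw [reduceOddPairs, oddCount_add, heven, h2, zero_add, Multiset.length_sort]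
    rfl
  refine ⟨nimClass_eq_iff.2 ⟨?_, by omega⟩, by omega⟩
  rw [reduceOddPairs, halves_add, h1, Multiset.sort_eq, ← halves_add, add_comm,
    Multiset.filter_add_not]

theorem sup_mem_of_mem {s : Multiset Ordinal.{u}} {a : Ordinal.{u}} (ha : a ∈ s) : s.sup ∈ s := by
  induction s using Multiset.induction generalizing a with
  | empty => simp at ha
  | cons b s ih =>
    rw [Multiset.sup_cons]
    rcases s.empty_or_exists_mem with rfl | ⟨c, hc⟩
    · simp
    · rcases max_choice b s.sup with h | h
      · rw [h]; exact Multiset.mem_cons_self b s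
      · rw [h]; exact Multiset.mem_cons_of_mem (ih hc)

/-- A position is reduced if it has no empty heaps, and at most one odd heap, which is then the
largest. -/
structure IsReduced (M : Multiset Ordinal.{u}) : Prop where
  ne_zero : ∀ a ∈ M, a ≠ 0
  oddCount_le : oddCount M ≤ 1
  le_of_oddSize : ∀ a ∈ M, OddSize a → ∀ b ∈ M, b ≤ a

theorem nimClass_moveOddToLargest {s : Multiset Ordinal.{u}} (hs : oddCount s ≤ 1) :
    nimClass (moveOddToLargest s) = nimClass s ∧ oddCount (moveOddToLargest s) ≤ 1 ∧
      ∀ a ∈ moveOddToLargest s, OddSize a → ∀ b ∈ moveOddToLargest s, b ≤ a := by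
  have hlen : (s.filter fun a => OddSize a).sort.length = oddCount s := Multiset.length_sort _
  unfold moveOddToLargest
  split
  next a ha =>
    have hf : (s.filter fun a => OddSize a) = {a} := by
      rw [← Multiset.sort_eq (s.filter fun a => OddSize a) (· ≤ ·), ha]; rfl
    have hmem : a ∈ s ∧ OddSize a := Multiset.mem_filter.1 (hf ▸ Multiset.mem_singleton_self a)
    have huniq : ∀ b ∈ s, OddSize b → b = a := fun b hb hbo =>
      Multiset.mem_singleton.1 (hf ▸ Multiset.mem_filter.2 ⟨hb, hbo⟩)
    have hsup : s.sup ∈ s := sup_mem_of_mem hmem.1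
    split_ifs with hlt
    · have hne : s.sup ≠ a := hlt.ne'
      have heven : ¬ OddSize s.sup := fun h => hne (huniq _ hsup h)
      have hle : ∀ b ∈ s, b ≤ s.sup := fun b hb => Multiset.le_sup hb
      generalize s.sup = t at *
      have ht : t ∈ s.erase a := (Multiset.mem_erase_of_ne hne).2 hsup
      have hsK : s = a ::ₘ t ::ₘ (s.erase a).erase t := by
        rw [Multiset.cons_erase ht, Multiset.cons_erase hmem.1]
      generalize (s.erase a).erase t = K at hsK
      subst hsK
      have hK : oddCount K = 0 := by
        simp only [oddCount_cons, if_pos hmem.2] at hs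
        omega
      have hpred := not_oddSize_pred hmem.2
      have hsucc := oddSize_add_one heven
      refine ⟨nimClass_eq_iff.2 ⟨?_, ?_⟩, ?_, ?_⟩
      · simp only [halves_cons, pred_div_two hmem.2, add_one_div_two heven]
      · simp only [oddCount_cons, hK, if_pos hmem.2, if_neg hpred, if_pos hsucc, if_neg heven]
      · simp only [oddCount_cons, hK, if_neg hpred, if_pos hsucc]
        omega
      · intro b hb hbo c hc
        rw [Multiset.mem_cons, Multiset.mem_cons] at hb hc
        have hb' : b = t + 1 := by
          rcases hb with rfl | rfl | hb
          · exact absurd hbo hpred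
          · rfl
          · exact absurd hbo (oddCount_eq_zero_iff.1 hK b hb)
        rw [hb']
        rcases hc with rfl | rfl | hc
        · exact (Ordinal.pred_le_self a).trans (hlt.le.trans (lt_add_one t).le)
        · exact le_rfl
        · exact (hle c (by simp [hc])).trans (lt_add_one t).le
    · refine ⟨rfl, hs, fun b hb hbo c hc => ?_⟩
      rw [huniq b hb hbo]
      exact (Multiset.le_sup hc).trans (not_lt.1 hlt)
  next hne =>
    have h0 : oddCount s = 0 := by
      by_contra h0
      obtain ⟨a, ha⟩ := List.length_eq_one_iff.1 (hlen.trans (by omega : oddCount s = 1))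
      exact hne a ha
    exact ⟨rfl, hs, fun a ha hao => absurd hao (oddCount_eq_zero_iff.1 h0 a ha)⟩

theorem nonzero_halves_nonzero (M : Multiset Ordinal.{u}) :
    nonzero (halves (nonzero M)) = nonzero (halves M) ∧ oddCount (nonzero M) = oddCount M := by
  induction M using Multiset.induction with
  | empty => exact ⟨rfl, rfl⟩
  | cons a M ih =>
    by_cases ha : a = 0
    · have h0 : ¬ OddSize (0 : Ordinal.{u}) := by simpa using not_oddSize_two_mul (0 : Ordinal.{u})
      rw [ha, nonzero_zero_cons, halves_cons, Ordinal.zero_div, nonzero_zero_cons, oddCount_cons,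
        if_neg h0, add_zero]
      exact ih
    · rw [nonzero_cons_of_ne ha, halves_cons, halves_cons, oddCount_cons, oddCount_cons, ih.2]
      refine ⟨?_, rfl⟩
      by_cases h : a / 2 = 0
      · rw [h, nonzero_zero_cons, nonzero_zero_cons, ih.1]
      · rw [nonzero_cons_of_ne h, nonzero_cons_of_ne h, ih.1]

theorem reducedForm_spec (A : List Ordinal.{u}) :
    nimClass (reducedForm A : Multiset Ordinal.{u}) = nimClass (A : Multiset Ordinal.{u}) ∧
      IsReduced (reducedForm A : Multiset Ordinal.{u}) := by
  obtain ⟨h1, h2⟩ := nimClass_reduceOddPairs (A : Multiset Ordinal.{u})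
  obtain ⟨h3, h4, h5⟩ := nimClass_moveOddToLargest h2
  rw [reducedForm, Multiset.sort_eq]
  generalize moveOddToLargest (reduceOddPairs (A : Multiset Ordinal.{u})) = t at *
  obtain ⟨h6, h7⟩ := nonzero_halves_nonzero t
  refine ⟨?_, fun a ha => (Multiset.mem_filter.1 ha).2, h7.trans_le h4,
    fun a ha hao b hb => h5 a (Multiset.mem_filter.1 ha).1 hao b (Multiset.mem_filter.1 hb).1⟩
  rw [← h1, ← h3]
  exact nimClass_eq_iff.2 ⟨h6, by rw [← h7]; rfl⟩

theorem eq_map_nonzero_halves {C : Multiset Ordinal.{u}} (h0 : ∀ a ∈ C, a ≠ 0)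
    (he : ∀ a ∈ C, ¬ OddSize a) : C = (nonzero (halves C)).map (2 * ·) := by
  induction C using Multiset.induction with
  | empty => rfl
  | cons a C ih =>
    have ha := eq_of_not_oddSize (he a (Multiset.mem_cons_self a C))
    have ha0 : a / 2 ≠ 0 := fun h =>
      h0 a (Multiset.mem_cons_self a C) (by rw [ha, h, mul_zero])
    rw [halves_cons, nonzero_cons_of_ne ha0, Multiset.map_cons, ← ha,
      ← ih (fun b hb => h0 b (Multiset.mem_cons_of_mem hb))
        (fun b hb => he b (Multiset.mem_cons_of_mem hb))]

theorem IsReduced.exists_cons {M : Multiset Ordinal.{u}} (h : IsReduced M)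
    (h1 : oddCount M = 1) : ∃ a C, M = a ::ₘ C ∧ OddSize a ∧
      C = (nonzero (halves C)).map (2 * ·) ∧ ∀ x ∈ nonzero (halves M), x ≤ a / 2 := by
  obtain ⟨a, ha⟩ := Multiset.exists_mem_of_ne_zero fun h0 =>
    one_ne_zero (h1.symm.trans (Multiset.card_eq_zero.2 h0))
  obtain ⟨haM, hodd⟩ := Multiset.mem_filter.1 ha
  obtain ⟨C, rfl⟩ := Multiset.exists_cons_of_mem haM
  rw [oddCount_cons, if_pos hodd] at h1
  refine ⟨a, C, rfl, hodd, eq_map_nonzero_halves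
    (fun b hb => h.ne_zero b (Multiset.mem_cons_of_mem hb))
    (oddCount_eq_zero_iff.1 (by omega)), fun x hx => ?_⟩
  obtain ⟨b, hb, rfl⟩ := Multiset.mem_map.1 (Multiset.mem_filter.1 hx).1
  exact Ordinal.div_le_left (h.le_of_oddSize a haM hodd b hb) 2

/-- A reduced position is determined by its invariant: the odd heap, if there is one, comes from
the largest half. -/
theorem IsReduced.eq_of_nimClass_eq {M N : Multiset Ordinal.{u}} (hM : IsReduced M)
    (hN : IsReduced N) (h : nimClass M = nimClass N) : M = N := by
  obtain ⟨h1, h2⟩ := nimClass_eq_iff.1 h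
  have h3 := hM.oddCount_le
  have h4 := hN.oddCount_le
  by_cases h0 : oddCount M = 0
  · rw [eq_map_nonzero_halves hM.ne_zero (oddCount_eq_zero_iff.1 h0),
      eq_map_nonzero_halves hN.ne_zero (oddCount_eq_zero_iff.1 (by omega)), h1]
  · obtain ⟨a, C, rfl, ha, hC, hCle⟩ := hM.exists_cons (by omega)
    obtain ⟨b, D, rfl, hb, hD, hDle⟩ := hN.exists_cons (by omega)
    have hle : ∀ {a b : Ordinal.{u}} {C D : Multiset Ordinal.{u}},
        nonzero (halves (a ::ₘ C)) = nonzero (halves (b ::ₘ D)) →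
        (∀ x ∈ nonzero (halves (b ::ₘ D)), x ≤ b / 2) → a / 2 ≤ b / 2 := by
      intro a b C D h hDle
      by_cases h0 : a / 2 = 0
      · rw [h0]; exact zero_le
      · refine hDle _ (h ▸ ?_)
        rw [halves_cons, nonzero_cons_of_ne h0]
        exact Multiset.mem_cons_self _ _
    have hab : a / 2 = b / 2 := le_antisymm (hle h1 hDle) (hle h1.symm hCle)
    have hCD : nonzero (halves C) = nonzero (halves D) := by
      rw [halves_cons, halves_cons, hab] at h1
      by_cases h0 : b / 2 = 0
      · rwa [h0, nonzero_zero_cons, nonzero_zero_cons] at h1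
      · rwa [nonzero_cons_of_ne h0, nonzero_cons_of_ne h0, Multiset.cons_inj_right] at h1
    rw [hC, hD, hCD, eq_of_oddSize ha, eq_of_oddSize hb, hab]

theorem nim_reducedForm_impEquiv (A : List Ordinal.{u}) :
    ImpEquiv (nim (reducedForm A)) (nim A) :=
  nim_impEquiv_of_nimClass_eq (reducedForm_spec A).1

theorem nim_impEquiv_iff_reducedForm_iso {A B : List Ordinal.{u}} :
    ImpEquiv (nim A) (nim B) ↔ Iso (nim (reducedForm A)) (nim (reducedForm B)) := by
  constructor
  · intro h
    obtain ⟨hA, hA'⟩ := reducedForm_spec A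
    obtain ⟨hB, hB'⟩ := reducedForm_spec B
    refine nim_iso_of_nonzero_eq (congrArg _ (hA'.eq_of_nimClass_eq hB' ?_))
    rw [hA, hB, nimClass_eq_of_impEquiv h]
  · intro h
    exact (nim_reducedForm_impEquiv A).symm.trans
      (h.impEquiv.trans (nim_reducedForm_impEquiv B))

theorem nim_pair_one_impEquiv (n : Ordinal.{u}) : ImpEquiv (nim [n, 1]) (nim [xorOne n]) :=
  ((Iso.refl (heap n)).add (nim_singleton_iso 1)).impEquiv.trans
    ((heap_add_one_impEquiv n).trans (nim_singleton_iso _).symm.impEquiv)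

end MisereNim

open MisereNim MisereNim.Game in
theorem mainTheorem3 :
    -- the recursive test for impartial equivalence
    (∀ G H : Game.{u}, G.IsImpartial → H.IsImpartial →
      (ImpEquiv G H ↔
        (∀ H' ∈ H.options,
          (∃ H'' ∈ H'.options, ImpEquiv H'' G) ∨ ∃ G' ∈ G.options, ImpEquiv G' H') ∧
        (∀ G' ∈ G.options,
          (∃ G'' ∈ G'.options, ImpEquiv G'' H) ∨ ∃ H' ∈ H.options, ImpEquiv H' G') ∧
        (Iso G 0 → H.outcome = .N) ∧ (Iso H 0 → G.outcome = .N))) ∧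
    -- the recursive test for the order on all games
    (∀ G H : Game.{u},
      (Geq G H ↔
        (∀ H₁ ∈ H.leftOptions,
          (∃ H₂ ∈ H₁.rightOptions, Geq G H₂) ∨ ∃ G₁ ∈ G.leftOptions, Geq G₁ H₁) ∧
        (∀ G₁ ∈ G.rightOptions,
          (∃ G₂ ∈ G₁.leftOptions, Geq G₂ H) ∨ ∃ H₁ ∈ H.rightOptions, Geq G₁ H₁) ∧
        (H.leftOptions = ∅ → G.leftOptions = ∅) ∧
        (G.rightOptions = ∅ → H.rightOptions = ∅))) ∧
    -- the recursive test for partizan equivalence of impartial games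
    (∀ G H : Game.{u}, G.IsImpartial → H.IsImpartial →
      (PartEquiv G H ↔
        (∀ H' ∈ H.options,
          (∃ H'' ∈ H'.options, PartEquiv H'' G) ∨ ∃ G' ∈ G.options, PartEquiv G' H') ∧
        (∀ G' ∈ G.options,
          (∃ G'' ∈ G'.options, PartEquiv G'' H) ∨ ∃ H' ∈ H.options, PartEquiv H' G') ∧
        (Iso G 0 ↔ Iso H 0))) ∧
    -- Nim positions are isomorphic iff their multisets of nonzero heap sizes agree
    (∀ A B : List Ordinal.{u},
      (Iso (nim A) (nim B) ↔
        (A : Multiset Ordinal.{u}).filter (fun a => a ≠ 0) =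
          (B : Multiset Ordinal.{u}).filter (fun a => a ≠ 0))) ∧
    -- partizan classification of Nim positions
    (∀ A B : List Ordinal.{u}, PartEquiv (nim A) (nim B) ↔ Iso (nim A) (nim B)) ∧
    -- adding a heap of size one
    (∀ n : Ordinal.{u}, ImpEquiv (nim [n, 1]) (nim [xorOne n])) ∧
    -- impartial classification of Nim positions
    (∀ A : List Ordinal.{u}, ImpEquiv (nim (reducedForm A)) (nim A)) ∧
    (∀ A B : List Ordinal.{u},
      ImpEquiv (nim A) (nim B) ↔ Iso (nim (reducedForm A)) (nim (reducedForm B))) := by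
  exact ⟨fun _ _ hG hH => impEquiv_iff_options hG hH, fun _ _ => geq_iff_options,
    fun _ _ hG hH => partEquiv_iff_options hG hH, fun _ _ => nim_iso_iff,
    fun _ _ => nim_partEquiv_iff, nim_pair_one_impEquiv, nim_reducedForm_impEquiv,
    fun _ _ => nim_impEquiv_iff_reducedForm_iso⟩
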